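/- **Conventions.** A *Hopf–Galois structure* on a number field $L$ is a finite-dimensional cocommutative $\mathbb{Q}$-Hopf algebra $H$ with a $\mathbb{Q}$-linear action on $L$ such that $L$ is an $H$-module algebra and the map $L\otimes_{\mathbb{Q}}H\to\mathrm{End}_{\mathbb{Q}}(L)$, $x\otimes h\mapsto(y\mapsto x(h\cdot y))$, is bijective. For a $\mathbb{Z}$-order $\mathcal{O}$ of $L$, its *associated order* in $H$ is $\mathfrak{A}_H(\mathcal{O})=\{h\in H : h\cdot\mathcal{O}\subseteq\mathcal{O}\}$, and $\mathcal{O}$ is an $\mathfrak{A}_H(\mathcal{O})$-module through the action. A *free generator* of $\mathcal{O}$ is a $\beta\in\mathcal{O}$ such that $h\mapsto h\cdot\beta$ is a bijection $\mathfrak{A}_H(\mathcal{O})\to\mathcal{O}$. Write $v_p$ for the $p$-adic valuation, with $v_p(0)=\infty$, and $[A,B,C]$ for the binary quadratic form $AX^2+BXY+CY^2$; it *represents* $n$ if it takes the value $n$ at some $(X,Y)\in\mathbb{Z}^2$. **Theorem.** Let $a,b\in\mathbb{Z}$ be such that, for every prime $p$, $v_p(a)\le 2$ or $v_p(b)\le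 3$. Let $L=\mathbb{Q}(\alpha)$ be a cubic number field, where $\alpha$ has minimal polynomial $x^3-ax+b$ over $\mathbb{Q}$. Put $\Delta=4a^3-27b^2$ and $g=\gcd(a,b)$, and let $H$ be the unique Hopf–Galois structure on $L/\mathbb{Q}$. 1. Suppose $3\nmid a$. The following are equivalent: - (i) $\mathbb{Z}[\alpha]$ is $\mathfrak{A}_H(\mathbb{Z}[\alpha])$-free; - (ii) there are $\beta_1,\beta_2,\beta_3\in\mathbb{Z}$ and $r,s\in\{-1,1\}$ with $3\beta_1+2a\beta_3=r$ and $3\frac{a}{g}\beta_2^2-9\frac{b}{g}\beta_2\beta_3+\frac{a^2}{g}\beta_3^2=s$; - (iii) there are $x,y\in\mathbb{Z}$ with $x^2+3\Delta y^2=12ag$ or $x^2+3\Delta y^2=-12ag$, with $6a\mid 9by+x$ or $6a\mid 9by-x$, and with $3\nmid y$. Moreover, whenever $x,y\in\mathbb{Z}$ satisfy $x^2+3\Delta y^2=\pm12ag$ and signs are chosen such that $\beta_1=\frac{\pm1-2ay}{3}$ and $\beta_2=\frac{9by\pm x}{6a}$ are integers, $\beta_1+\beta_2\alpha+y\alpha^2$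 is a free generator of $\mathbb{Z}[\alpha]$ over $\mathfrak{A}_H(\mathbb{Z}[\alpha])$. 2. Suppose $3\mid a$ and $v_3(a)\le v_3(b)$. The following are equivalent: - (i) $\mathbb{Z}[\alpha]$ is $\mathfrak{A}_H(\mathbb{Z}[\alpha])$-free; - (ii) the form $\left[\frac{a}{g},-3\frac{b}{g},\frac{a^2}{3g}\right]$ represents $1$ or $-1$; - (iii) there are $x,y\in\mathbb{Z}$ with $x^2+3\Delta y^2=36ag$ or $x^2+3\Delta y^2=-36ag$, and with $6a\mid 9by+x$ or $6a\mid 9by-x$. Moreover, whenever $x,y\in\mathbb{Z}$ satisfy $x^2+3\Delta y^2=\pm36ag$ and a sign is chosen such that $\beta_2=\frac{9by\pm x}{6a}$ is an integer, $\left(1-\frac{2a}{3}y\right)+\beta_2\alpha+y\alpha^2$ is a free generator of $\mathbb{Z}[\alpha]$ over $\mathfrak{A}_H(\mathbb{Z}[\alpha])$. 3. Suppose $v_3(a)>v_3(b)$. The following are equivalent: - (i) $\mathbb{Z}[\alpha]$ is $\mathfrak{A}_H(\mathbb{Z}[\alpha])$-free; - (ii) the form $\left[\frac{a}{3g},-\frac{b}{g},\frac{a^2}{9g}\right]$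 represents $1$ or $-1$; - (iii) there are $x,y\in\mathbb{Z}$ with $x^2+3\Delta y^2=108ag$ or $x^2+3\Delta y^2=-108ag$, and with $6a\mid 9by+x$ or $6a\mid 9by-x$. Moreover, if $a\ne0$, then whenever $x,y\in\mathbb{Z}$ satisfy $x^2+3\Delta y^2=\pm108ag$ and a sign is chosen such that $\beta_2=\frac{9by\pm x}{6a}$ is an integer, $\left(1-\frac{2a}{3}y\right)+\beta_2\alpha+y\alpha^2$ is a free generator of $\mathbb{Z}[\alpha]$ over $\mathfrak{A}_H(\mathbb{Z}[\alpha])$. -/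

import Mathlib

open Polynomial IntermediateField
open scoped TensorProduct

namespace HopfGaloisModule

section General

variable (K L H : Type*) [Field K] [Field L] [Algebra K L] [Ring H] [HopfAlgebra K H]
  [Module H L] [IsScalarTower K H L]

/-- For fixed `x : L`, the `K`-linear map `H → L`, `h ↦ h • x`. -/
def actOn (x : L) : H →ₗ[K] L :=
  (LinearMap.toSpanSingleton H L x).restrictScalars K

/-- For fixed `x y : L`, the `K`-linear map `H ⊗ H → L`, `h₁ ⊗ h₂ ↦ (h₁ • x) * (h₂ • y)`. -/
noncomputable def actOnMul (x y : L) : H ⊗[K] H →ₗ[K] L :=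
  TensorProduct.lift ((LinearMap.mul K L).compl₁₂ (actOn K L H x) (actOn K L H y))

/-- The canonical map `ι : L ⊗ H → End_K(L)`, `ι (x ⊗ h) y = x * (h • y)`. -/
noncomputable def canonicalMap : L ⊗[K] H →ₗ[K] Module.End K L :=
  TensorProduct.lift ((LinearMap.mul K (Module.End K L)).compl₁₂
    (Algebra.lmul K L).toLinearMap (Algebra.lsmul K K L).toLinearMap)

/-- The `K`-Hopf algebra `H`, together with its `K`-linear action on `L`, is a Hopf-Galois
structure on `L / K`: `H` is finite-dimensional and cocommutative, `L` is an `H`-module algebra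
(the fields `smul_one` and `smul_mul`; in Sweedler notation the latter reads
`h • (x * y) = ∑ (h₍₁₎ • x) * (h₍₂₎ • y)`), and the canonical map `L ⊗ H → End_K(L)` is
bijective. -/
structure IsHopfGalois : Prop where
  finite : Module.Finite K H
  cocomm : Coalgebra.IsCocomm K H
  smul_one : ∀ h : H, h • (1 : L) = algebraMap K L (Coalgebra.counit (R := K) h)
  smul_mul : ∀ (h : H) (x y : L),
    h • (x * y) = actOnMul K L H x y (Coalgebra.comul (R := K) h)
  bijective : Function.Bijective (canonicalMap K L H)

variable {K L H}

theorem actOn_apply (x : L) (h : H) : actOn K L H x h = h • x := rfl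

theorem actOnMul_tmul (x y : L) (h₁ h₂ : H) :
    actOnMul K L H x y (h₁ ⊗ₜ[K] h₂) = (h₁ • x) * (h₂ • y) := by
  simp [actOnMul, actOn_apply]

theorem canonicalMap_tmul (x : L) (h : H) (y : L) :
    canonicalMap K L H (x ⊗ₜ[K] h) y = x * (h • y) := by
  simp [canonicalMap]

end General

section AssociatedOrder

variable {L : Type*} (H : Type*) [Field L] [Ring H] [Module H L]

/-- The associated order `𝔄_H(𝒪) = {h ∈ H ∣ h • 𝒪 ⊆ 𝒪}` of `𝒪` in `H`. -/
def associatedOrder (O : Subalgebra ℤ L) : Subring H where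
  carrier := {h | ∀ x ∈ O, h • x ∈ O}
  mul_mem' {h k} hh hk x hx := by
    rw [mul_smul]
    exact hh _ (hk x hx)
  one_mem' x hx := by simpa using hx
  add_mem' {h k} hh hk x hx := by
    rw [add_smul]
    exact O.add_mem (hh x hx) (hk x hx)
  zero_mem' x _ := by
    rw [zero_smul]
    exact O.zero_mem
  neg_mem' {h} hh x hx := by
    rw [neg_smul]
    exact O.neg_mem (hh x hx)

/-- `𝒪` is a module over its associated order, by restricting the action of `H` on `L`. -/
instance associatedOrderModule (O : Subalgebra ℤ L) : Module (associatedOrder H O) O where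
  smul h x := ⟨(h : H) • (x : L), h.2 x x.2⟩
  one_smul x := Subtype.ext (one_smul H (x : L))
  mul_smul h k x := Subtype.ext (mul_smul (h : H) (k : H) (x : L))
  smul_zero h := Subtype.ext (smul_zero (h : H))
  smul_add h x y := Subtype.ext (smul_add (h : H) (x : L) (y : L))
  add_smul h k x := Subtype.ext (add_smul (h : H) (k : H) (x : L))
  zero_smul x := Subtype.ext (zero_smul H (x : L))

/-- `β` is a free generator of `𝒪` over its associated order: every element of `𝒪` is `h • β`
for exactly one `h` in the associated order. -/
def IsFreeGenerator (O : Subalgebra ℤ L) (β : O) : Prop :=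
  Function.Bijective fun h : associatedOrder H O => h • β

end AssociatedOrder

/-- The element `β₁ + β₂ α + β₃ α²` of `ℤ[α]`. -/
def ofCoords {L : Type*} [Field L] (α : L) (β₁ β₂ β₃ : ℤ) : Algebra.adjoin ℤ {α} :=
  let A : Algebra.adjoin ℤ {α} := ⟨α, Algebra.self_mem_adjoin_singleton ℤ α⟩
  (β₁ : Algebra.adjoin ℤ {α}) + (β₂ : Algebra.adjoin ℤ {α}) * A
    + (β₃ : Algebra.adjoin ℤ {α}) * A ^ 2

/-- The binary quadratic form `[A, B, C] = A X² + B X Y + C Y²` represents `n`, that is, takes the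
value `n` at some pair of integers. -/
def Represents (A B C n : ℚ) : Prop :=
  ∃ X Y : ℤ, A * (X : ℚ) ^ 2 + B * (X : ℚ) * (Y : ℚ) + C * (Y : ℚ) ^ 2 = n

end HopfGaloisModule

/-!
The proof determines the action of `H` on `L` explicitly, and then the associated order of `ℤ[α]`.

*The action.* Over an algebraic closure `Ω` the three embeddings `σ i : L → Ω` form a basis of
`Hom_ℚ(L, Ω)`, so `σ i (h • y) = ∑ j, M i j h * σ j y` for linear maps `M i j : H → Ω`
(`embCoeff`). Since `L` is a module algebra, each row of `M` consists of orthogonal idempotents for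
convolution (`conv_embCoeff`); they are nonzero because the canonical map is surjective, so they
form an `Ω`-basis of `Hom_ℚ(H, Ω)`. That algebra is commutative, so all rows hold the same
idempotents, up to order, and multiplicativity of `M` turns the reorderings into a regular
permutation group of the embeddings (`exists_regular_embCoeff`). On three points this is the cyclic
group, so `M` is circulant (`exists_circulant`). Descending to `ℚ`, the image of `H` in `End_ℚ(L)`
is the set of all `p + q Tr + r W` with `p, q, r ∈ ℚ`, where `W` is the explicit operator of
`traceOperator` (`exists_act_eq_traceOperator`, `exists_act_eq`).

*The associated order.* The operator `p + q Tr + r W` preserves `ℤ[α]` if and only if six linear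
expressions in `p, q, r` are integers. This gives the associated order integral coordinates
`(n, m, ρ)`, with `r = ρ / N`, where `N` is `2 g` for `3 ∤ a` and `6 gcd(a, 3 b)` for `3 ∣ a`. In
these coordinates `h ↦ h • β` is an integral `3 × 3` matrix whose determinant is, up to sign, a
linear form in `β₁, β₃` times a binary quadratic form in `β₂, β₃`
(`isFreeGenerator_iff_isUnit`, `det_actionMatrix`). So `β` is a free generator if and only if both
factors are units. By comparing dimensions, `ℤ[α]` is free if and only if a free generator exists
(`free_iff_exists_isFreeGenerator`). Completing the square in the quadratic form, whose
discriminant is a multiple of `-3 Δ`, gives the conditions on `x² + 3 Δ y²`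
(`tfae_of_not_three_dvd`, `tfae_of_three_dvd`).
-/

namespace HopfGaloisModule

/-! ### The matrix of a Hopf-Galois action on the embeddings -/

section Embeddings

variable {K L H Ω ι : Type*} [Field K] [Field L] [Algebra K L] [Field Ω] [Algebra K Ω]
  [Ring H] [HopfAlgebra K H]

/-- The convolution product of two `K`-linear maps `H → Ω`, `h ↦ ∑ c h₍₁₎ * d h₍₂₎`. -/
noncomputable def conv (c d : H →ₗ[K] Ω) : H →ₗ[K] Ω :=
  TensorProduct.lift ((LinearMap.mul K Ω).compl₁₂ c d) ∘ₗ Coalgebra.comul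

theorem conv_apply (c d : H →ₗ[K] Ω) (h : H) :
    conv c d h = TensorProduct.lift ((LinearMap.mul K Ω).compl₁₂ c d) (Coalgebra.comul (R := K) h) :=
  rfl

theorem conv_sum_smul_right [Fintype ι] (c : H →ₗ[K] Ω) (w : ι → Ω) (d : ι → H →ₗ[K] Ω) :
    conv c (∑ k, w k • d k) = ∑ k, w k • conv c (d k) := by
  ext h
  simp only [conv_apply, LinearMap.sum_apply, LinearMap.smul_apply]
  induction Coalgebra.comul (R := K) h using TensorProduct.induction_on with
  | zero => simp
  | tmul x y =>
    simp only [TensorProduct.lift.tmul, LinearMap.compl₁₂_apply, LinearMap.mul_apply',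
      LinearMap.sum_apply, LinearMap.smul_apply, Finset.mul_sum, smul_eq_mul]
    exact Finset.sum_congr rfl fun _ _ => by ring
  | add s t hs ht => simp only [map_add, hs, ht, smul_add, Finset.sum_add_distrib]

theorem conv_comm [Coalgebra.IsCocomm K H] (c d : H →ₗ[K] Ω) : conv c d = conv d c := by
  ext h
  rw [conv_apply, ← Coalgebra.comm_comul K h, conv_apply]
  induction Coalgebra.comul (R := K) h using TensorProduct.induction_on with
  | zero => simp
  | tmul x y => simp [mul_comm]
  | add s t hs ht => simp only [map_add, hs, ht]

theorem conv_sum_smul_left [Coalgebra.IsCocomm K H] [Fintype ι] (w : ι → Ω)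
    (c : ι → H →ₗ[K] Ω) (d : H →ₗ[K] Ω) :
    conv (∑ k, w k • c k) d = ∑ k, w k • conv (c k) d := by
  rw [conv_comm, conv_sum_smul_right]
  simp only [conv_comm]

variable [Module H L] [IsScalarTower K H L]

/-- The coefficients of the action of `H` on `L` in an `Ω`-basis `B` of `Hom_K(L, Ω)` that consists
of embeddings `σ`: they are defined by `σ i (h • y) = ∑ j, embCoeff B σ i j h * σ j y`. -/
noncomputable def embCoeff (B : Module.Basis ι Ω (L →ₗ[K] Ω)) (σ : ι → L →ₐ[K] Ω) (i j : ι) :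
    H →ₗ[K] Ω :=
  (B.coord j).restrictScalars K ∘ₗ (σ i).toLinearMap.compRight K ∘ₗ
    (Algebra.lsmul K K L : H →ₐ[K] Module.End K L).toLinearMap

variable {B : Module.Basis ι Ω (L →ₗ[K] Ω)} {σ : ι → L →ₐ[K] Ω}

/-- No coefficient vanishes, because the image of the canonical map is all of `End_K(L)`. -/
theorem embCoeff_ne_zero [FiniteDimensional K L] (hH : IsHopfGalois K L H) (i j : ι) :
    embCoeff (H := H) B σ i j ≠ 0 := by
  intro h0
  have h1 : ∀ t : L ⊗[K] H, B.coord j ((σ i).toLinearMap ∘ₗ canonicalMap K L H t) = 0 := by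
    intro t
    induction t using TensorProduct.induction_on with
    | zero => simp
    | tmul x h =>
      have : (σ i).toLinearMap ∘ₗ canonicalMap K L H (x ⊗ₜ h) = σ i x •
          ((σ i).toLinearMap ∘ₗ (Algebra.lsmul K K L : H →ₐ[K] Module.End K L) h) := by
        ext y
        simp [canonicalMap_tmul]
      rw [this, map_smul]
      have h2 := LinearMap.congr_fun h0 h
      simp only [embCoeff, LinearMap.comp_apply, LinearMap.zero_apply] at h2
      rw [show B.coord j ((σ i).toLinearMap ∘ₗ
        (Algebra.lsmul K K L : H →ₐ[K] Module.End K L) h) = 0 from h2, smul_zero]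
    | add s t hs ht => rw [map_add, LinearMap.comp_add, map_add, hs, ht, add_zero]
  have h2 : ∀ φ : L →ₗ[K] Ω, B.coord j φ = 0 := by
    intro φ
    let b := Module.finBasis K L
    have : φ = ∑ n, φ (b n) • ((σ i).toLinearMap ∘ₗ (b.coord n).smulRight (1 : L)) := by
      refine b.ext fun m => ?_
      simp [Finsupp.single_apply]
    rw [this, map_sum]
    refine Finset.sum_eq_zero fun n _ => ?_
    obtain ⟨t, ht⟩ := hH.bijective.2 ((b.coord n).smulRight (1 : L))
    rw [map_smul, ← ht, h1, smul_zero]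
  simpa using h2 (B j)

variable [Fintype ι]

theorem embCoeff_spec (hB : ∀ i, B i = (σ i).toLinearMap) (i : ι) (h : H) (y : L) :
    σ i (h • y) = ∑ j, embCoeff B σ i j h * σ j y := by
  have := congrArg (fun φ : L →ₗ[K] Ω => φ y)
    (B.sum_repr ((σ i).toLinearMap ∘ₗ (Algebra.lsmul K K L : H →ₐ[K] Module.End K L) h))
  simp only [LinearMap.sum_apply, LinearMap.smul_apply, hB, smul_eq_mul, AlgHom.toLinearMap_apply,
    LinearMap.comp_apply, Algebra.lsmul_coe] at this
  exact this.symm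

theorem eq_of_sum_mul_emb_eq (hB : ∀ i, B i = (σ i).toLinearMap) {w w' : ι → Ω}
    (h : ∀ y, ∑ j, w j * σ j y = ∑ j, w' j * σ j y) : w = w' := by
  refine funext (Fintype.linearIndependent_iffₛ.1 B.linearIndependent w w' ?_)
  ext y
  simpa [hB] using h y

theorem emb_actOnMul (hB : ∀ i, B i = (σ i).toLinearMap) (i : ι) (x y : L) (t : H ⊗[K] H) :
    σ i (actOnMul K L H x y t) = ∑ j, (∑ k, TensorProduct.lift ((LinearMap.mul K Ω).compl₁₂
      (embCoeff B σ i j) (embCoeff B σ i k)) t * σ k y) * σ j x := by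
  induction t using TensorProduct.induction_on with
  | zero => simp
  | tmul h₁ h₂ =>
    rw [actOnMul_tmul, map_mul, embCoeff_spec hB, embCoeff_spec hB, Finset.sum_mul]
    refine Finset.sum_congr rfl fun j _ => ?_
    simp only [TensorProduct.lift.tmul, LinearMap.compl₁₂_apply, LinearMap.mul_apply',
      Finset.mul_sum, Finset.sum_mul]
    exact Finset.sum_congr rfl fun _ _ => by ring
  | add s t hs ht => simp only [map_add, hs, ht, add_mul, Finset.sum_add_distrib]

/-- As `L` is an `H`-module algebra and embeddings are multiplicative, every row of coefficients
consists of orthogonal idempotents for the convolution product. -/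
theorem conv_embCoeff [DecidableEq ι] (hB : ∀ i, B i = (σ i).toLinearMap)
    (hH : IsHopfGalois K L H) (i j k : ι) :
    conv (embCoeff B σ i j) (embCoeff (H := H) B σ i k) =
      if j = k then embCoeff B σ i j else 0 := by
  ext h
  have key : ∀ x y : L, ∑ j, (∑ k, conv (embCoeff B σ i j) (embCoeff B σ i k) h * σ k y) * σ j x
      = ∑ j, (∑ k, (if j = k then embCoeff B σ i j h else 0) * σ k y) * σ j x := by
    intro x y
    simp only [conv_apply]
    rw [← emb_actOnMul hB, ← hH.smul_mul, embCoeff_spec hB]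
    refine Finset.sum_congr rfl fun j _ => ?_
    simp only [ite_mul, zero_mul, Finset.sum_ite_eq, Finset.mem_univ, if_true, map_mul]
    ring
  have h1 := fun y => congrFun (eq_of_sum_mul_emb_eq hB fun x => key x y) j
  have h2 := congrFun (eq_of_sum_mul_emb_eq hB h1) k
  rw [h2]
  split_ifs <;> rfl

theorem sum_embCoeff (hB : ∀ i, B i = (σ i).toLinearMap) (hH : IsHopfGalois K L H) (i i' : ι) :
    ∑ j, embCoeff B σ i j = ∑ j, embCoeff (H := H) B σ i' j := by
  ext h
  have h1 := fun i => embCoeff_spec hB i h 1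
  simp only [hH.smul_one, map_one, mul_one, AlgHom.commutes] at h1
  simp only [LinearMap.sum_apply, ← h1]

theorem embCoeff_one [DecidableEq ι] (hB : ∀ i, B i = (σ i).toLinearMap) (i j : ι) :
    embCoeff B σ i j (1 : H) = if i = j then 1 else 0 := by
  refine congrFun (eq_of_sum_mul_emb_eq (w := fun j => embCoeff B σ i j (1 : H))
    (w' := fun j => if i = j then 1 else 0) hB fun y => ?_) j
  rw [← embCoeff_spec hB]
  simp

theorem embCoeff_mul (hB : ∀ i, B i = (σ i).toLinearMap) (i j : ι) (h h' : H) :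
    embCoeff B σ i j (h * h') = ∑ l, embCoeff B σ i l h * embCoeff B σ l j h' := by
  refine congrFun (eq_of_sum_mul_emb_eq (w := fun j => embCoeff B σ i j (h * h'))
    (w' := fun j => ∑ l, embCoeff B σ i l h * embCoeff B σ l j h') hB fun y => ?_) j
  rw [← embCoeff_spec hB, mul_smul, embCoeff_spec hB]
  simp only [embCoeff_spec hB, Finset.mul_sum, Finset.sum_mul]
  rw [Finset.sum_comm]
  exact Finset.sum_congr rfl fun _ _ => Finset.sum_congr rfl fun _ _ => by ring

theorem linearIndependent_embCoeff [DecidableEq ι] (hB : ∀ i, B i = (σ i).toLinearMap)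
    [FiniteDimensional K L] (hH : IsHopfGalois K L H) (i : ι) :
    LinearIndependent Ω fun j => embCoeff (H := H) B σ i j := by
  rw [Fintype.linearIndependent_iff]
  intro w hw j
  have h1 : conv (embCoeff B σ i j) (∑ k, w k • embCoeff (H := H) B σ i k) = 0 := by
    rw [hw]
    ext h
    simp only [conv_apply]
    induction Coalgebra.comul (R := K) h using TensorProduct.induction_on with
    | zero => simp
    | tmul x y => simp
    | add s t hs ht => rw [map_add, hs, ht]; simp
  rw [conv_sum_smul_right] at h1
  simp only [conv_embCoeff hB hH, smul_ite, smul_zero, Finset.sum_ite_eq, Finset.mem_univ,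
    if_true] at h1
  exact (smul_eq_zero.1 h1).resolve_right (embCoeff_ne_zero hH i j)

theorem finrank_eq_of_isHopfGalois [FiniteDimensional K L] (hH : IsHopfGalois K L H) :
    Module.finrank K H = Module.finrank K L := by
  have := hH.finite
  have h1 := (LinearEquiv.ofBijective _ hH.bijective).finrank_eq
  rw [Module.finrank_tensorProduct, Module.finrank_linearMap] at h1
  exact Nat.eq_of_mul_eq_mul_left Module.finrank_pos h1

/-- The orthogonal idempotents in row `i` of the coefficients are those of row `i₀`, up to order:
`f k i` is the column of row `i` that holds entry `k` of row `i₀`. -/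
theorem exists_embCoeff_eq_sum [DecidableEq ι] (hB : ∀ i, B i = (σ i).toLinearMap)
    [FiniteDimensional K L] (hH : IsHopfGalois K L H) (i₀ : ι) :
    ∃ f : ι → ι → ι, ∀ i j, embCoeff (H := H) B σ i j =
      ∑ k, (if f k i = j then (1 : Ω) else 0) • embCoeff B σ i₀ k := by
  have := hH.finite
  have := hH.cocomm
  have : Nonempty ι := ⟨i₀⟩
  have hcard : Fintype.card ι = Module.finrank Ω (H →ₗ[K] Ω) := by
    rw [Module.finrank_linearMap_self, finrank_eq_of_isHopfGalois hH,
      ← Module.finrank_linearMap_self K Ω L, Module.finrank_eq_card_basis B]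
  let C := basisOfLinearIndependentOfCardEqFinrank (linearIndependent_embCoeff hB hH i₀) hcard
  have hC : ∀ k, C k = embCoeff B σ i₀ k := fun k => by
    simp [C]
  let m : ι → ι → ι → Ω := fun i j k => C.repr (embCoeff B σ i j) k
  have hm : ∀ i j, embCoeff B σ i j = ∑ k, m i j k • embCoeff (H := H) B σ i₀ k := fun i j => by
    simp only [m, ← hC, C.sum_repr]
  have hinj : ∀ {w w' : ι → Ω}, ∑ k, w k • embCoeff (H := H) B σ i₀ k =
      ∑ k, w' k • embCoeff B σ i₀ k → w = w' := by
    intro w w' h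
    simp only [← hC] at h
    funext k
    simpa [Finsupp.single_apply] using congrArg (fun φ => C.repr φ k) h
  have horth : ∀ i j j', (fun k => m i j k * m i j' k) =
      fun k => if j = j' then m i j k else 0 := by
    intro i j j'
    apply hinj
    have h1 := conv_embCoeff (H := H) hB hH i j j'
    rw [hm i j, hm i j', conv_sum_smul_left] at h1
    simp only [conv_sum_smul_right, conv_embCoeff hB hH, smul_ite, smul_zero, Finset.sum_ite_eq,
      Finset.mem_univ, if_true, smul_smul] at h1
    rw [h1]
    split_ifs <;> simp
  have hsum : ∀ i, (fun k => ∑ j, m i j k) = fun _ => 1 := by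
    intro i
    apply hinj
    have h1 := sum_embCoeff (H := H) hB hH i i₀
    simp only [one_smul, ← h1, hm i]
    rw [Finset.sum_comm]
    simp only [Finset.sum_smul]
  have hex : ∀ k i, ∃ j, m i j k ≠ 0 := by
    intro k i
    by_contra! h
    simpa [h] using congrFun (hsum i) k
  choose f hf using hex
  refine ⟨f, fun i j => (hm i j).trans (Finset.sum_congr rfl fun k _ => ?_)⟩
  congr 1
  split_ifs with hj
  · subst hj
    have := congrFun (horth i (f k i) (f k i)) k
    simpa [hf k i] using this
  · have := congrFun (horth i (f k i) j) k
    simpa [hf k i, hj] using this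

/-- The bookkeeping functions of `exists_embCoeff_eq_sum` form a monoid under composition. For a
Hopf-Galois structure they are the regular permutation group of Greither and Pareigis. -/
theorem exists_regular_embCoeff [DecidableEq ι] (hB : ∀ i, B i = (σ i).toLinearMap)
    [FiniteDimensional K L] (hH : IsHopfGalois K L H) (i₀ : ι) :
    ∃ f : ι → ι → ι, (∀ i j, embCoeff (H := H) B σ i j =
        ∑ k, (if f k i = j then (1 : Ω) else 0) • embCoeff B σ i₀ k) ∧
      (∀ i, f i₀ i = i) ∧ (∀ k, f k i₀ = k) ∧ (∀ i j, ∃ k, f k i = j) ∧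
      ∀ k l i, f (f l k) i = f l (f k i) := by
  obtain ⟨f, hf⟩ := exists_embCoeff_eq_sum (H := H) hB hH i₀
  have hli := linearIndependent_embCoeff (H := H) hB hH i₀
  have hinj : ∀ {w w' : ι → Ω}, (∀ h, ∑ k, w k * embCoeff (H := H) B σ i₀ k h =
      ∑ k, w' k * embCoeff B σ i₀ k h) → w = w' := by
    intro w w' h
    refine funext (Fintype.linearIndependent_iffₛ.1 hli w w' ?_)
    ext x
    simpa using h x
  have hfapp : ∀ i j h, embCoeff (H := H) B σ i j h =
      ∑ k, (if f k i = j then 1 else 0) * embCoeff B σ i₀ k h := by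
    intro i j h
    rw [hf i j]
    simp only [LinearMap.sum_apply, LinearMap.smul_apply, smul_eq_mul]
  have hid : ∀ i, f i₀ i = i := by
    intro i
    have h1 := hfapp i i 1
    simp only [embCoeff_one hB, if_true, mul_ite, mul_one, mul_zero, Finset.sum_ite_eq,
      Finset.mem_univ] at h1
    by_contra h
    simp [h] at h1
  have hbase : ∀ k, f k i₀ = k := by
    intro k
    have h1 := congrFun (hinj (w := fun l => if l = k then 1 else 0)
      (w' := fun l => if f l i₀ = k then 1 else 0) fun h => by
        rw [← hfapp i₀ k h]; simp) k
    by_contra h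
    simp [h] at h1
  refine ⟨f, hf, hid, hbase, ?_, ?_⟩
  · intro i j
    by_contra! h
    apply embCoeff_ne_zero (H := H) (B := B) (σ := σ) hH i j
    rw [hf i j]
    simp [h]
  · intro k l i
    -- Expand coefficient `(i, j)` of a product `h * h'` in two ways.
    have h1 : ∀ j h h', ∑ k, (∑ l, (if f (f l k) i = j then (1 : Ω) else 0) *
          embCoeff (H := H) B σ i₀ l h') * embCoeff (H := H) B σ i₀ k h =
        ∑ k, (∑ l, (if f l (f k i) = j then (1 : Ω) else 0) *
          embCoeff B σ i₀ l h') * embCoeff B σ i₀ k h := by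
      intro j h h'
      have e1 : embCoeff (H := H) B σ i j (h * h') = ∑ k, (∑ l,
          (if f l (f k i) = j then (1 : Ω) else 0) *
          embCoeff B σ i₀ l h') * embCoeff B σ i₀ k h := by
        rw [embCoeff_mul hB]
        simp only [hfapp i _ h, Finset.sum_mul]
        rw [Finset.sum_comm]
        refine Finset.sum_congr rfl fun k _ => ?_
        simp only [ite_mul, one_mul, zero_mul, Finset.sum_ite_eq, Finset.mem_univ, if_true]
        rw [hfapp _ j h', Finset.mul_sum]
        exact Finset.sum_congr rfl fun l _ => by simp [mul_comm]
      rw [← e1, hfapp i j (h * h')]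
      simp only [embCoeff_mul hB, Finset.mul_sum]
      rw [Finset.sum_comm]
      refine Finset.sum_congr rfl fun k _ => ?_
      simp only [hfapp k _ h', Finset.mul_sum, Finset.sum_mul]
      rw [Finset.sum_comm]
      refine Finset.sum_congr rfl fun l _ => ?_
      rw [Finset.sum_eq_single (f l k)]
      · simp only [ite_mul, mul_ite, one_mul, zero_mul, if_true, mul_comm]
      · intro m _ hm
        simp [hm.symm]
      · simp
    have h2 := fun h' => congrFun (hinj fun h => h1 (f l (f k i)) h h') k
    have h3 := congrFun (hinj h2) l
    by_contra h
    simp [h] at h3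

end Embeddings

/-- The only regular permutation group on `Fin 3` is generated by the cycle `i ↦ i + 1`. -/
theorem regular_fin_three (f : Fin 3 → Fin 3 → Fin 3) (h₀ : ∀ i, f 0 i = i) (hb : ∀ k, f k 0 = k)
    (hs : ∀ i j, ∃ k, f k i = j) (hm : ∀ k l i, f (f l k) i = f l (f k i)) (k i : Fin 3) :
    f k i = i + k := by
  have key : ∀ x y z w : Fin 3, ((x = 0 ∨ z = 0) ∧ (x = 2 ∨ z = 2) ∧ (y = 0 ∨ w = 0) ∧
      (y = 1 ∨ w = 1) ∧ x ≠ 0 ∧ (x = 2 → y = 1 → w = x)) →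
      x = 2 ∧ y = 0 ∧ z = 0 ∧ w = 1 := by decide
  have hs' : ∀ i j, i ≠ j → f 1 i = j ∨ f 2 i = j := by
    intro i j hij
    obtain ⟨k, hk⟩ := hs i j
    fin_cases k
    · exact absurd ((h₀ i).symm.trans hk) hij
    · exact Or.inl hk
    · exact Or.inr hk
  have hx : f 1 1 ≠ 0 := by
    intro hx
    -- Otherwise `f 1` is an involution that exchanges `0` and `1`, hence fixes `2`, as does `f 0`.
    have h2 := hm 1 1 2
    rw [hx, h₀] at h2
    have h3 : ∀ y w : Fin 3, (y = 0 ∨ w = 0) → (y = 1 ∨ w = 1) → y = 0 ∨ y = 1 := by decide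
    rcases h3 _ _ (hs' 2 0 (by decide)) (hs' 2 1 (by decide)) with h | h
    · rw [h, hb] at h2
      exact absurd h2 (by decide)
    · rw [h, hx] at h2
      exact absurd h2 (by decide)
  obtain ⟨h1, h2, h3, h4⟩ := key (f 1 1) (f 1 2) (f 2 1) (f 2 2) ⟨hs' 1 0 (by decide),
    hs' 1 2 (by decide), hs' 2 0 (by decide), hs' 2 1 (by decide), hx, fun hx hy => by
      have h2 := hm 1 1 2
      rwa [hx, hy] at h2⟩
  fin_cases k
  · simp [h₀]
  · fin_cases i
    · simp [hb]
    · simp [h1]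
    · simp [h2]
  · fin_cases i
    · simp [hb]
    · simp [h3]
    · simp [h4]

/-- On a cubic extension, every element of a Hopf-Galois structure acts on the three embeddings
through a circulant matrix. -/
theorem exists_circulant {K L H Ω : Type*} [Field K] [Field L] [Algebra K L] [Field Ω]
    [Algebra K Ω] [Ring H] [HopfAlgebra K H] [Module H L] [IsScalarTower K H L]
    [FiniteDimensional K L] (hH : IsHopfGalois K L H) {σ : Fin 3 → L →ₐ[K] Ω}
    (hσ : Function.Injective σ) (hL : Module.finrank K L = 3) (h : H) :
    ∃ c : Fin 3 → Ω, ∀ i y, σ i (h • y) =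
      c 0 * σ i y + c 1 * σ (i + 1) y + c 2 * σ (i + 2) y := by
  have hli : LinearIndependent Ω fun i => (σ i).toLinearMap :=
    (linearIndependent_toLinearMap K L Ω).comp σ hσ
  let B := basisOfLinearIndependentOfCardEqFinrank hli
    (by rw [Module.finrank_linearMap_self, hL, Fintype.card_fin])
  have hB : ∀ i, B i = (σ i).toLinearMap := fun i => by simp [B]
  obtain ⟨f, hf, h₀, hb, hs, hm⟩ := exists_regular_embCoeff (H := H) hB hH 0
  have hr := regular_fin_three f h₀ hb hs hm
  refine ⟨fun k => embCoeff B σ 0 k h, fun i y => ?_⟩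
  rw [embCoeff_spec hB]
  simp only [hf i, hr, LinearMap.sum_apply, LinearMap.smul_apply, smul_eq_mul, ite_mul, one_mul,
    zero_mul, Finset.sum_mul]
  rw [Finset.sum_comm]
  simp [Fin.sum_univ_three]

/-! ### The Hopf-Galois structure on a cubic field in coordinates -/

section CubicField

variable {L : Type*} [Field L] [CharZero L] {α : L} {a b : ℤ} {P : Module.Basis (Fin 3) ℚ L}

/-- A primitive element of degree `3` gives the `ℚ`-basis `1, α, α²`. -/
theorem exists_powerBasis [NumberField L] (hdeg : (minpoly ℚ α).natDegree = 3)
    (hgen : ℚ⟮α⟯ = ⊤) : ∃ P : Module.Basis (Fin 3) ℚ L, ∀ i, P i = α ^ (i : ℕ) := by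
  have hfin : Module.finrank ℚ L = 3 := by
    rw [← hdeg]
    exact ((Field.primitive_element_iff_minpoly_natDegree_eq ℚ α).1 hgen).symm
  have hli : LinearIndependent ℚ fun i : Fin 3 => α ^ (i : ℕ) := by
    have := (linearIndependent_pow (K := ℚ) α).comp (Fin.cast hdeg.symm)
      (Fin.cast_injective hdeg.symm)
    simpa [Function.comp_def] using this
  exact ⟨basisOfLinearIndependentOfCardEqFinrank hli (by simp [hfin]), fun i => by simp⟩

theorem exists_coords (hP : ∀ i, P i = α ^ (i : ℕ)) (x : L) :
    ∃ u v w : ℚ, x = u + v * α + w * α ^ 2 := by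
  refine ⟨P.repr x 0, P.repr x 1, P.repr x 2, ?_⟩
  conv_lhs => rw [← P.sum_repr x]
  simp [Fin.sum_univ_three, hP, Rat.smul_def]

theorem coords_unique (hP : ∀ i, P i = α ^ (i : ℕ)) {u v w u' v' w' : ℚ}
    (h : (u : L) + v * α + w * α ^ 2 = u' + v' * α + w' * α ^ 2) :
    u = u' ∧ v = v' ∧ w = w' := by
  have h1 : ![u, v, w] = ![u', v', w'] := by
    refine funext (Fintype.linearIndependent_iffₛ.1 P.linearIndependent _ _ ?_)
    simpa [Fin.sum_univ_three, hP, Rat.smul_def] using h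
  exact ⟨congrFun h1 0, congrFun h1 1, congrFun h1 2⟩

theorem constCoeff_ne_zero (hP : ∀ i, P i = α ^ (i : ℕ))
    (hα : α ^ 3 = a * α - b) : b ≠ 0 := by
  rintro rfl
  have h0 : α ≠ 0 := fun h => by
    have := (coords_unique hP (u := 0) (v := 1) (w := 0) (u' := 0) (v' := 0) (w' := 0)
      (by simp [h])).2.1
    exact one_ne_zero this
  have h1 : α ^ 2 = a := by
    apply mul_left_cancel₀ h0
    linear_combination hα + (by push_cast; ring : (0 : L) = ((0 : ℤ) : L))
  have := (coords_unique hP (u := a) (v := 0) (w := 0) (u' := 0) (v' := 0) (w' := 1)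
    (by simp [h1])).2.2
  exact zero_ne_one this

/-- The operator `p + q Tr + r W` on `L`, given by its values on the basis `P = (1, α, α²)`.
Here `Tr` is the trace of `L / ℚ`, and `W` is the descent to `L` of the operator `δ (τ - τ²)`,
with `τ` the rotation of the three conjugates `α₀, α₁, α₂` of `α` and
`δ = (α₀ - α₁) (α₁ - α₂) (α₂ - α₀)` the square root of the discriminant. -/
noncomputable def traceOperator (P : Module.Basis (Fin 3) ℚ L) (α : L) (a b : ℤ) (p q r : ℚ) :
    Module.End ℚ L :=
  P.constr ℚ ![((p + 3 * q : ℚ) : L),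
    p * α + r * (4 * a ^ 2 - 9 * b * α - 6 * a * α ^ 2),
    p * α ^ 2 + q * (2 * a) + r * (-6 * a * b + 2 * a ^ 2 * α + 9 * b * α ^ 2)]

theorem traceOperator_one (hP : ∀ i, P i = α ^ (i : ℕ)) (p q r : ℚ) :
    traceOperator P α a b p q r 1 = ((p + 3 * q : ℚ) : L) := by
  have h : P 0 = 1 := by simp [hP]
  have h' : traceOperator P α a b p q r (P 0) = _ := P.constr_basis ℚ _ 0
  rw [h] at h'
  exact h'

theorem traceOperator_gen (hP : ∀ i, P i = α ^ (i : ℕ)) (p q r : ℚ) :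
    traceOperator P α a b p q r α =
      p * α + r * (4 * a ^ 2 - 9 * b * α - 6 * a * α ^ 2) := by
  have h : P 1 = α := by simp [hP]
  have h' : traceOperator P α a b p q r (P 1) = _ := P.constr_basis ℚ _ 1
  rw [h] at h'
  exact h'

theorem traceOperator_gen_sq (hP : ∀ i, P i = α ^ (i : ℕ)) (p q r : ℚ) :
    traceOperator P α a b p q r (α ^ 2) =
      p * α ^ 2 + q * (2 * a) + r * (-6 * a * b + 2 * a ^ 2 * α + 9 * b * α ^ 2) := by
  have h : P 2 = α ^ 2 := by simp [hP]
  have h' : traceOperator P α a b p q r (P 2) = _ := P.constr_basis ℚ _ 2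
  rw [h] at h'
  exact h'

theorem end_ext (hP : ∀ i, P i = α ^ (i : ℕ)) {M : Type*} [AddCommGroup M] [Module ℚ M]
    {f g : L →ₗ[ℚ] M} (h0 : f 1 = g 1) (h1 : f α = g α) (h2 : f (α ^ 2) = g (α ^ 2)) : f = g := by
  refine P.ext fun i => ?_
  rw [hP]
  fin_cases i
  · simpa using h0
  · simpa using h1
  · simpa using h2

theorem quadratic_coeffs_eq_zero {F : Type*} [Field F] {x y z A B C : F} (hxy : x ≠ y)
    (hyz : y ≠ z) (hzx : z ≠ x) (h0 : A + B * x + C * x ^ 2 = 0) (h1 : A + B * y + C * y ^ 2 = 0)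
    (h2 : A + B * z + C * z ^ 2 = 0) : A = 0 ∧ B = 0 ∧ C = 0 := by
  have e1 : B + C * (x + y) = 0 := by
    apply mul_left_cancel₀ (sub_ne_zero.2 hxy)
    linear_combination h0 - h1
  have e2 : B + C * (y + z) = 0 := by
    apply mul_left_cancel₀ (sub_ne_zero.2 hyz)
    linear_combination h1 - h2
  have hC : C = 0 := by
    apply mul_left_cancel₀ (sub_ne_zero.2 hzx)
    linear_combination e2 - e1
  have hB : B = 0 := by linear_combination e1 - (x + y) * hC
  exact ⟨by linear_combination h0 - x * hB - x ^ 2 * hC, hB, hC⟩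

/-- Vieta's formulas for the depressed cubic `X³ - a X + b`. -/
theorem vieta_of_distinct_roots {F : Type*} [Field F] {x y z A B : F} (hxy : x ≠ y)
    (hyz : y ≠ z) (hzx : z ≠ x) (h0 : x ^ 3 = A * x - B) (h1 : y ^ 3 = A * y - B)
    (h2 : z ^ 3 = A * z - B) :
    x + y + z = 0 ∧ A = x ^ 2 + x * y + y ^ 2 ∧ B = x * y * (x + y) := by
  have e1 : x ^ 2 + x * y + y ^ 2 - A = 0 := by
    apply mul_left_cancel₀ (sub_ne_zero.2 hxy)
    linear_combination h0 - h1
  have e2 : y ^ 2 + y * z + z ^ 2 - A = 0 := by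
    apply mul_left_cancel₀ (sub_ne_zero.2 hyz)
    linear_combination h1 - h2
  refine ⟨?_, by linear_combination -e1, by linear_combination h0 - x * e1⟩
  apply mul_left_cancel₀ (sub_ne_zero.2 hzx)
  linear_combination e2 - e1

variable {H : Type*} [Ring H] [HopfAlgebra ℚ H] [Module H L] [IsScalarTower ℚ H L]

/-- Every element of `H` acts as a rational combination of `1`, `Tr` and `W`: circulant matrices are
spanned by those of the three operators, and comparing coordinates in `1, α, α²` shows that the
coefficients are rational. -/
theorem exists_act_eq_traceOperator (hP : ∀ i, P i = α ^ (i : ℕ))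
    (hα : α ^ 3 = a * α - b) (hH : IsHopfGalois ℚ L H) (h : H) :
    ∃ p q r : ℚ, (Algebra.lsmul ℚ ℚ L : H →ₐ[ℚ] Module.End ℚ L) h =
      traceOperator P α a b p q r := by
  have : FiniteDimensional ℚ L := P.finiteDimensional_of_finite
  have hL : Module.finrank ℚ L = 3 := by simp [Module.finrank_eq_card_basis P]
  have hcard : Fintype.card (L →ₐ[ℚ] AlgebraicClosure ℚ) = 3 := by rw [AlgHom.card, hL]
  let e := (Fintype.equivFinOfCardEq hcard).symm
  let σ : Fin 3 → L →ₐ[ℚ] AlgebraicClosure ℚ := e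
  obtain ⟨c, hc⟩ := exists_circulant hH (σ := σ) e.injective hL h
  have hs : ∀ i j, i ≠ j → σ i α ≠ σ j α := by
    intro i j hij h
    apply hij
    apply e.injective
    have : (σ i).toLinearMap = (σ j).toLinearMap :=
      end_ext hP (by simp) (by simpa using h) (by simp [h])
    exact AlgHom.toLinearMap_injective this
  have hcub : ∀ i, σ i α ^ 3 = a * σ i α - b := fun i => by
    rw [← map_pow, hα]
    simp
  obtain ⟨v0, v1, v2⟩ := vieta_of_distinct_roots (hs 0 1 (by decide)) (hs 1 2 (by decide))
    (hs 2 0 (by decide)) (hcub 0) (hcub 1) (hcub 2)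
  have hδ : (σ 0 α - σ 1 α) * (σ 1 α - σ 2 α) * (σ 2 α - σ 0 α) ≠ 0 :=
    mul_ne_zero (mul_ne_zero (sub_ne_zero.2 (hs 0 1 (by decide)))
      (sub_ne_zero.2 (hs 1 2 (by decide)))) (sub_ne_zero.2 (hs 2 0 (by decide)))
  set δ := (σ 0 α - σ 1 α) * (σ 1 α - σ 2 α) * (σ 2 α - σ 0 α) with hδ'
  obtain ⟨r', hr'⟩ : ∃ r', c 1 - c 2 = 2 * δ * r' :=
    ⟨(2 * δ)⁻¹ * (c 1 - c 2), (mul_inv_cancel_left₀ (mul_ne_zero two_ne_zero hδ) _).symm⟩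
  obtain ⟨q', hq'⟩ : ∃ q', c 1 + c 2 = 2 * q' := ⟨(c 1 + c 2) / 2, by ring⟩
  obtain ⟨p', hp'⟩ : ∃ p', c 0 = p' + q' := ⟨c 0 - q', by ring⟩
  have hc1 : c 1 = q' + δ * r' := by linear_combination (hr' + hq') / 2
  have hc2 : c 2 = q' - δ * r' := by linear_combination (hq' - hr') / 2
  have hz : σ 2 α = -σ 0 α - σ 1 α := by linear_combination v0
  have f1 : ∀ i, σ i (h • α) = p' * σ i α + r' * (4 * a ^ 2 - 9 * b * σ i α - 6 * a * σ i α ^ 2) := by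
    intro i
    rw [hc i α, hp', hc1, hc2, v2, v1, hδ', hz]
    fin_cases i
    · simp [hz]; ring
    · simp [hz]; ring
    · simp [hz]; ring
  have f2 : ∀ i, σ i (h • α ^ 2) = p' * σ i α ^ 2 + q' * (2 * a) +
      r' * (-6 * a * b + 2 * a ^ 2 * σ i α + 9 * b * σ i α ^ 2) := by
    intro i
    rw [hc i (α ^ 2), hp', hc1, hc2, v2, v1, hδ', hz]
    fin_cases i
    · simp [hz]; ring
    · simp [hz]; ring
    · simp [hz]; ring
  have f0 : σ 0 (h • 1) = p' + 3 * q' := by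
    rw [hc 0 1, hp', hc1, hc2]
    simp; ring
  obtain ⟨u, v, w, huvw⟩ := exists_coords hP (h • α)
  obtain ⟨u', v', w', huvw'⟩ := exists_coords hP (h • α ^ 2)
  have g1 : ∀ i, (4 * a ^ 2 * r' - u) + (p' - 9 * b * r' - v) * σ i α +
      (-6 * a * r' - w) * σ i α ^ 2 = 0 := by
    intro i
    have := f1 i
    rw [huvw] at this
    simp only [map_add, map_mul, map_pow, map_ratCast] at this
    linear_combination -this
  have g2 : ∀ i, (2 * a * q' - 6 * a * b * r' - u') + (2 * a ^ 2 * r' - v') * σ i α +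
      (p' + 9 * b * r' - w') * σ i α ^ 2 = 0 := by
    intro i
    have := f2 i
    rw [huvw'] at this
    simp only [map_add, map_mul, map_pow, map_ratCast] at this
    linear_combination -this
  obtain ⟨-, k1, -⟩ := quadratic_coeffs_eq_zero (hs 0 1 (by decide)) (hs 1 2 (by decide))
    (hs 2 0 (by decide)) (g1 0) (g1 1) (g1 2)
  obtain ⟨-, -, k2⟩ := quadratic_coeffs_eq_zero (hs 0 1 (by decide)) (hs 1 2 (by decide))
    (hs 2 0 (by decide)) (g2 0) (g2 1) (g2 2)
  have hb : (b : AlgebraicClosure ℚ) ≠ 0 := Int.cast_ne_zero.2 (constCoeff_ne_zero hP hα)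
  have hp : p' = ((v + w') / 2 : ℚ) := by push_cast; linear_combination (k1 + k2) / 2
  have hr : r' = ((w' - v) / (18 * b) : ℚ) := by
    push_cast
    rw [eq_div_iff (mul_ne_zero (by norm_num) hb)]
    linear_combination k2 - k1
  have hq : q' = ((Coalgebra.counit h - (v + w') / 2) / 3 : ℚ) := by
    rw [hH.smul_one, AlgHom.commutes, eq_ratCast, hp] at f0
    push_cast at f0 ⊢
    linear_combination -f0 / 3
  have hn : ∀ n : ℕ, [n.AtLeastTwo] → σ 0 (OfNat.ofNat n) = OfNat.ofNat n :=
    fun n _ => map_ofNat (σ 0) n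
  refine ⟨(v + w') / 2, (Coalgebra.counit h - (v + w') / 2) / 3, (w' - v) / (18 * b),
    end_ext hP ?_ ?_ ?_⟩
  · rw [traceOperator_one hP, Algebra.lsmul_coe]
    apply (σ 0).injective
    change σ 0 (h • (1 : L)) = σ 0 _
    rw [f0, hp, hq]
    simp [hn]
  · rw [traceOperator_gen hP, Algebra.lsmul_coe]
    apply (σ 0).injective
    change σ 0 (h • α) = σ 0 _
    rw [f1, hp, hr]
    simp [hn]
  · rw [traceOperator_gen_sq hP, Algebra.lsmul_coe]
    apply (σ 0).injective
    change σ 0 (h • α ^ 2) = σ 0 _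
    rw [f2, hp, hq, hr]
    simp [hn]

/-- `traceOperator` as a linear function of its three parameters. -/
noncomputable def traceOperatorLin (P : Module.Basis (Fin 3) ℚ L) (α : L) (a b : ℤ) :
    (Fin 3 → ℚ) →ₗ[ℚ] Module.End ℚ L where
  toFun v := traceOperator P α a b (v 0) (v 1) (v 2)
  map_add' v w := by
    refine P.ext fun i => ?_
    simp only [traceOperator, LinearMap.add_apply, Module.Basis.constr_basis]
    fin_cases i <;> simp <;> ring
  map_smul' t v := by
    refine P.ext fun i => ?_
    simp only [traceOperator, LinearMap.smul_apply, Module.Basis.constr_basis, RingHom.id_apply]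
    fin_cases i <;> simp [Rat.smul_def] <;> ring

theorem act_injective (hH : IsHopfGalois ℚ L H) :
    Function.Injective (Algebra.lsmul ℚ ℚ L : H →ₐ[ℚ] Module.End ℚ L) := by
  intro h h' hh
  apply Algebra.TensorProduct.includeRight_injective (R := ℚ) (A := L) (B := H)
    (FaithfulSMul.algebraMap_injective ℚ L)
  apply hH.bijective.1
  ext y
  simpa [canonicalMap_tmul] using LinearMap.congr_fun hh y

/-- Every rational combination of `1`, `Tr` and `W` is the action of an element of `H`: these
operators form a space of dimension at most `3`, which contains the image of `H`. -/
theorem exists_act_eq (hP : ∀ i, P i = α ^ (i : ℕ))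
    (hα : α ^ 3 = a * α - b) (hH : IsHopfGalois ℚ L H) (p q r : ℚ) :
    ∃ h : H, (Algebra.lsmul ℚ ℚ L : H →ₐ[ℚ] Module.End ℚ L) h = traceOperator P α a b p q r := by
  have : FiniteDimensional ℚ L := P.finiteDimensional_of_finite
  have := hH.finite
  let θ := (Algebra.lsmul ℚ ℚ L : H →ₐ[ℚ] Module.End ℚ L).toLinearMap
  have hle : LinearMap.range θ ≤ LinearMap.range (traceOperatorLin P α a b) := by
    rintro _ ⟨h, rfl⟩
    obtain ⟨p, q, r, e⟩ := exists_act_eq_traceOperator hP hα hH h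
    exact ⟨![p, q, r], e.symm⟩
  have heq := Submodule.eq_of_le_of_finrank_le hle (by
    rw [LinearMap.finrank_range_of_inj (f := θ) (act_injective hH), finrank_eq_of_isHopfGalois hH,
      Module.finrank_eq_card_basis P]
    simpa using LinearMap.finrank_range_le (traceOperatorLin P α a b))
  have : traceOperator P α a b p q r ∈ LinearMap.range θ := by
    rw [heq]
    exact ⟨![p, q, r], rfl⟩
  exact this

end CubicField

/-! ### Free generators and determinants -/

section FreeGenerator

theorem intCast_smul_eq_mul {H L : Type*} [Ring H] [Field L] [Module H L] (n : ℤ) (x : L) :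
    (n : H) • x = (n : L) * x := by
  rw [Int.cast_smul_eq_zsmul, zsmul_eq_mul]

theorem coe_ofCoords {L : Type*} [Field L] (α : L) (u v w : ℤ) :
    (ofCoords α u v w : L) = u + v * α + w * α ^ 2 := by
  simp [ofCoords]

variable {L : Type*} [Field L] {α : L} {a b : ℤ}

theorem mem_adjoin_iff (hα : α ^ 3 = a * α - b) {x : L} :
    x ∈ Algebra.adjoin ℤ {α} ↔ ∃ u v w : ℤ, x = u + v * α + w * α ^ 2 := by
  constructor
  · intro hx
    induction hx using Algebra.adjoin_induction with
    | mem x hx =>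
      obtain rfl := Set.mem_singleton_iff.1 hx
      exact ⟨0, 1, 0, by simp⟩
    | algebraMap n => exact ⟨n, 0, 0, by simp⟩
    | add x y _ _ hx hy =>
      obtain ⟨u, v, w, rfl⟩ := hx
      obtain ⟨u', v', w', rfl⟩ := hy
      exact ⟨u + u', v + v', w + w', by push_cast; ring⟩
    | mul x y _ _ hx hy =>
      obtain ⟨u, v, w, rfl⟩ := hx
      obtain ⟨u', v', w', rfl⟩ := hy
      refine ⟨u * u' - b * (v * w' + w * v'), u * v' + v * u' + a * (v * w' + w * v') - b * (w * w'),
        u * w' + v * v' + w * u' + a * (w * w'), ?_⟩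
      push_cast
      linear_combination ((v * w' + w * v') + w * w' * α) * hα
  · rintro ⟨u, v, w, rfl⟩
    rw [← coe_ofCoords]
    exact (ofCoords α u v w).2

variable [CharZero L] {P : Module.Basis (Fin 3) ℚ L}

theorem ofCoords_bijective (hP : ∀ i, P i = α ^ (i : ℕ)) (hα : α ^ 3 = a * α - b) :
    Function.Bijective fun v : Fin 3 → ℤ => ofCoords α (v 0) (v 1) (v 2) := by
  constructor
  · intro v w h
    have h1 := congrArg (fun x : Algebra.adjoin ℤ {α} => (x : L)) h
    simp only [coe_ofCoords] at h1
    obtain ⟨e0, e1, e2⟩ := coords_unique hP (u := v 0) (v := v 1) (w := v 2)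
      (u' := w 0) (v' := w 1) (w' := w 2) (by exact_mod_cast h1)
    funext i
    fin_cases i
    · exact_mod_cast e0
    · exact_mod_cast e1
    · exact_mod_cast e2
  · rintro ⟨x, hx⟩
    obtain ⟨u, v, w, rfl⟩ := (mem_adjoin_iff hα).1 hx
    exact ⟨![u, v, w], Subtype.ext (coe_ofCoords α u v w)⟩

theorem traceOperator_coords (hP : ∀ i, P i = α ^ (i : ℕ)) (p q r : ℚ) (u v w : ℤ) :
    traceOperator P α a b p q r (u + v * α + w * α ^ 2) =
      ((u * (p + 3 * q) + v * (4 * a ^ 2 * r) + w * (2 * a * q - 6 * a * b * r) : ℚ) : L) +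
      ((v * (p - 9 * b * r) + w * (2 * a ^ 2 * r) : ℚ) : L) * α +
      ((v * (-6 * a * r) + w * (p + 9 * b * r) : ℚ) : L) * α ^ 2 := by
  have h : (u : L) + v * α + w * α ^ 2 = u • (1 : L) + v • α + w • α ^ 2 := by
    simp only [zsmul_eq_mul, mul_one]
  rw [h]
  rw [map_add, map_add, map_zsmul, map_zsmul, map_zsmul, traceOperator_one hP,
    traceOperator_gen hP, traceOperator_gen_sq hP]
  simp only [zsmul_eq_mul]
  push_cast
  ring

theorem exists_int_mul_mem (hP : ∀ i, P i = α ^ (i : ℕ)) (hα : α ^ 3 = a * α - b) (x : L) :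
    ∃ n : ℤ, n ≠ 0 ∧ (n : L) * x ∈ Algebra.adjoin ℤ {α} := by
  obtain ⟨u, v, w, rfl⟩ := exists_coords hP x
  refine ⟨u.den * v.den * w.den, by simp, (mem_adjoin_iff hα).2
    ⟨u.num * v.den * w.den, v.num * u.den * w.den, w.num * u.den * v.den, ?_⟩⟩
  have h : ∀ t : ℚ, (t.den : L) * t = t.num := fun t => by
    exact_mod_cast congrArg (fun s : ℚ => (s : L)) (Rat.den_mul_eq_num t)
  push_cast
  linear_combination (v.den * w.den : L) * h u + (u.den * w.den : L) * h v * α +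
    (u.den * v.den : L) * h w * α ^ 2

variable {H : Type*} [Ring H] [Module H L]

theorem exists_int_mul_mem_associatedOrder (hP : ∀ i, P i = α ^ (i : ℕ))
    (hα : α ^ 3 = a * α - b) (h : H) :
    ∃ n : ℤ, n ≠ 0 ∧ (n : H) * h ∈ associatedOrder H (Algebra.adjoin ℤ {α}) := by
  obtain ⟨n₀, hn₀, h₀⟩ := exists_int_mul_mem hP hα (h • (1 : L))
  obtain ⟨n₁, hn₁, h₁⟩ := exists_int_mul_mem hP hα (h • α)
  obtain ⟨n₂, hn₂, h₂⟩ := exists_int_mul_mem hP hα (h • α ^ 2)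
  refine ⟨n₀ * n₁ * n₂, by simp [hn₀, hn₁, hn₂], fun x hx => ?_⟩
  obtain ⟨u, v, w, rfl⟩ := (mem_adjoin_iff hα).1 hx
  have e : (u : L) + v * α + w * α ^ 2 = u • (1 : L) + v • α + w • α ^ 2 := by
    simp only [zsmul_eq_mul, mul_one]
  have e' : (((n₀ * n₁ * n₂ : ℤ) : H) * h) • ((u : L) + v * α + w * α ^ 2) =
      (u * n₁ * n₂) • ((n₀ : L) * h • (1 : L)) + (v * n₀ * n₂) • ((n₁ : L) * h • α) +
      (w * n₀ * n₁) • ((n₂ : L) * h • α ^ 2) := by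
    rw [mul_smul, intCast_smul_eq_mul, e, smul_add, smul_add, smul_comm h u, smul_comm h v, smul_comm h w]
    simp only [zsmul_eq_mul]
    push_cast
    ring
  rw [e']
  exact add_mem (add_mem (zsmul_mem h₀ _) (zsmul_mem h₁ _)) (zsmul_mem h₂ _)

variable [HopfAlgebra ℚ H] [IsScalarTower ℚ H L]

/-- `ℤ[α]` spans a `ℚ`-space of the same dimension as its associated order, so it can only be free
of rank one. -/
theorem free_iff_exists_isFreeGenerator (hP : ∀ i, P i = α ^ (i : ℕ))
    (hα : α ^ 3 = a * α - b) (hH : IsHopfGalois ℚ L H) :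
    Module.Free (associatedOrder H (Algebra.adjoin ℤ {α})) (Algebra.adjoin ℤ {α}) ↔
      ∃ β, IsFreeGenerator H (Algebra.adjoin ℤ {α}) β := by
  have : FiniteDimensional ℚ L := P.finiteDimensional_of_finite
  have := hH.finite
  constructor
  · intro hfree
    let c := Module.Free.chooseBasis (associatedOrder H (Algebra.adjoin ℤ {α}))
      (Algebra.adjoin ℤ {α})
    obtain ⟨i⟩ : Nonempty (Module.Free.ChooseBasisIndex (associatedOrder H (Algebra.adjoin ℤ {α}))
        (Algebra.adjoin ℤ {α})) := c.index_nonempty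
    have hinj : Function.Injective fun h : associatedOrder H (Algebra.adjoin ℤ {α}) => h • c i := by
      intro h h' e
      simpa using congrArg (fun x => c.repr x i) e
    have hcast : ∀ n : ℤ, n ≠ 0 → ∀ h : H, (n : H) * h = 0 → h = 0 := by
      intro n hn h e
      have e1 : (n : ℚ) • h = 0 := by rw [Algebra.smul_def, map_intCast, e]
      exact (smul_eq_zero.1 e1).resolve_left (Int.cast_ne_zero.2 hn)
    let φ : H →ₗ[ℚ] L := actOn ℚ L H (c i : L)
    have hφ : Function.Injective φ := by
      rw [injective_iff_map_eq_zero]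
      intro h e
      obtain ⟨n, hn, hmem⟩ := exists_int_mul_mem_associatedOrder hP hα h
      have e1 : (⟨n * h, hmem⟩ : associatedOrder H (Algebra.adjoin ℤ {α})) = 0 := by
        apply hinj
        apply Subtype.ext
        change ((n : H) * h) • (c i : L) = (0 : H) • (c i : L)
        rw [mul_smul, show h • (c i : L) = 0 from e, smul_zero, zero_smul]
      exact hcast n hn h (congrArg Subtype.val e1)
    have hφs : Function.Surjective φ :=
      (LinearMap.injective_iff_surjective_of_finrank_eq_finrank
        (finrank_eq_of_isHopfGalois hH)).1 hφ
    have hsub : ∀ j, j = i := by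
      intro j
      by_contra hj
      obtain ⟨h, hh⟩ := hφs (c j : L)
      obtain ⟨n, hn, hmem⟩ := exists_int_mul_mem_associatedOrder hP hα h
      have e1 : (⟨n * h, hmem⟩ : associatedOrder H (Algebra.adjoin ℤ {α})) • c i =
          (n : associatedOrder H (Algebra.adjoin ℤ {α})) • c j := by
        apply Subtype.ext
        change ((n : H) * h) • (c i : L) = ((n : associatedOrder H _) : H) • (c j : L)
        rw [mul_smul, show h • (c i : L) = c j from hh]
        simp
      have e2 := congrArg (fun x => ((c.repr x j : associatedOrder H _) : H)) e1
      simp only [map_smul, Module.Basis.repr_self, Finsupp.smul_apply,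
        Finsupp.single_eq_same, Finsupp.single_eq_of_ne hj, smul_eq_mul, mul_zero, mul_one,
        ZeroMemClass.coe_zero] at e2
      have e3 : (1 : H) = 0 := hcast n hn 1 (by rw [mul_one]; simpa using e2.symm)
      have e4 : (1 : H) • (1 : L) = 0 := by rw [e3, zero_smul]
      exact one_ne_zero ((one_smul H (1 : L)).symm.trans e4)
    refine ⟨c i, hinj, fun x => ⟨c.repr x i, ?_⟩⟩
    apply c.repr.injective
    ext j
    obtain rfl := hsub j
    simp
  · rintro ⟨β, hβ⟩
    exact Module.Free.of_equiv (LinearEquiv.ofBijective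
      (LinearMap.toSpanSingleton (associatedOrder H (Algebra.adjoin ℤ {α})) _ β) hβ)

/-- If `p + 3 q = κ m + τ n`, `p - 9 b r = m` and `N r = ρ`, this is the matrix that takes
`(n, m, ρ)` to the coordinates of `(p + q Tr + r W) (u + v α + w α²)`; the integers `A₁`, `A₂`,
`A₃`, `C`, `D`, `E` stand for `2 a² / N`, `6 a / N`, `18 b / N`, `2 a A₃ / 3`, `2 a (κ - 1) / 3`
and `2 a τ / 3`. -/
def actionMatrix (A₁ A₂ A₃ C D E κ τ u v w : ℤ) : Matrix (Fin 3) (Fin 3) ℤ :=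
  !![τ * u + E * w, κ * u + D * w, 2 * A₁ * v - C * w;
    0, v, A₁ * w;
    0, w, A₃ * w - A₂ * v]

theorem det_actionMatrix (A₁ A₂ A₃ C D E κ τ u v w : ℤ) :
    (actionMatrix A₁ A₂ A₃ C D E κ τ u v w).det =
      -((τ * u + E * w) * (A₂ * v ^ 2 - A₃ * v * w + A₁ * w ^ 2)) := by
  rw [actionMatrix, Matrix.det_fin_three]
  simp
  ring

theorem traceOperator_actionMatrix (hP : ∀ i, P i = α ^ (i : ℕ))
    {N A₁ A₂ A₃ C D E κ τ : ℤ} (hN : N ≠ 0) (h₁ : N * A₁ = 2 * a ^ 2)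
    (h₂ : N * A₂ = 6 * a) (h₃ : N * A₃ = 18 * b) (hC : 3 * C = 2 * a * A₃)
    (hD : 3 * D = 2 * a * (κ - 1)) (hE : 3 * E = 2 * a * τ) {n m ρ : ℤ} {p q r : ℚ}
    (hr : N * r = ρ) (hm : p - 9 * b * r = m) (hn : p + 3 * q = κ * m + τ * n) (u v w : ℤ) :
    traceOperator P α a b p q r (ofCoords α u v w) =
      (ofCoords α ((actionMatrix A₁ A₂ A₃ C D E κ τ u v w).mulVec ![n, m, ρ] 0)
        ((actionMatrix A₁ A₂ A₃ C D E κ τ u v w).mulVec ![n, m, ρ] 1)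
        ((actionMatrix A₁ A₂ A₃ C D E κ τ u v w).mulVec ![n, m, ρ] 2) : L) := by
  have hN' : (N : ℚ) ≠ 0 := Int.cast_ne_zero.2 hN
  have e₁ : 2 * (a : ℚ) ^ 2 * r = A₁ * ρ := by
    rw [← hr, show 2 * (a : ℚ) ^ 2 = N * A₁ by exact_mod_cast h₁.symm]; ring
  have e₂ : 6 * (a : ℚ) * r = A₂ * ρ := by
    rw [← hr, show 6 * (a : ℚ) = N * A₂ by exact_mod_cast h₂.symm]; ring
  have e₃ : 18 * (b : ℚ) * r = A₃ * ρ := by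
    rw [← hr, show 18 * (b : ℚ) = N * A₃ by exact_mod_cast h₃.symm]; ring
  have hC' : 3 * (C : ℚ) = 2 * a * A₃ := by exact_mod_cast hC
  have hD' : 3 * (D : ℚ) = 2 * a * (κ - 1) := by exact_mod_cast hD
  have hE' : 3 * (E : ℚ) = 2 * a * τ := by exact_mod_cast hE
  rw [coe_ofCoords, coe_ofCoords, traceOperator_coords hP]
  have c₀ : (u * (p + 3 * q) + v * (4 * a ^ 2 * r) + w * (2 * a * q - 6 * a * b * r) : ℚ) =
      ((actionMatrix A₁ A₂ A₃ C D E κ τ u v w).mulVec ![n, m, ρ] 0 : ℤ) := by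
    simp [actionMatrix, Matrix.mulVec, dotProduct, Fin.sum_univ_three]
    linear_combination (u + w * (2 * a / 3)) * hn + 2 * v * e₁ - w * (2 * a / 3) * hm
      - w * (2 * a / 3) * e₃ - w * n * hE' / 3 - w * m * hD' / 3 + w * ρ * hC' / 3
  have c₁ : (v * (p - 9 * b * r) + w * (2 * a ^ 2 * r) : ℚ) =
      ((actionMatrix A₁ A₂ A₃ C D E κ τ u v w).mulVec ![n, m, ρ] 1 : ℤ) := by
    simp [actionMatrix, Matrix.mulVec, dotProduct, Fin.sum_univ_three]
    linear_combination v * hm + w * e₁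
  have c₂ : (v * (-6 * a * r) + w * (p + 9 * b * r) : ℚ) =
      ((actionMatrix A₁ A₂ A₃ C D E κ τ u v w).mulVec ![n, m, ρ] 2 : ℤ) := by
    simp [actionMatrix, Matrix.mulVec, dotProduct, Fin.sum_univ_three]
    linear_combination -v * e₂ + w * hm + w * e₃
  rw [c₀, c₁, c₂]
  simp only [Rat.cast_intCast]

/-- The criterion for free generators, given integral coordinates `(n, m, ρ)` on the associated
order: `β` generates freely if and only if the integral matrix of `h ↦ h • β` is invertible. -/
theorem isFreeGenerator_iff_isUnit (hP : ∀ i, P i = α ^ (i : ℕ)) (hα : α ^ 3 = a * α - b)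
    (hH : IsHopfGalois ℚ L H) {N A₁ A₂ A₃ C D E κ τ : ℤ} (hN : N ≠ 0) (hτ : τ ≠ 0)
    (h₁ : N * A₁ = 2 * a ^ 2) (h₂ : N * A₂ = 6 * a) (h₃ : N * A₃ = 18 * b)
    (hC : 3 * C = 2 * a * A₃) (hD : 3 * D = 2 * a * (κ - 1)) (hE : 3 * E = 2 * a * τ)
    (hint : ∀ (p q r : ℚ) (i₀ i₁ i₂ i₃ i₄ i₅ : ℤ), p + 3 * q = i₀ → p - 9 * b * r = i₁ →
      6 * a * r = i₂ → 2 * a * q - 6 * a * b * r = i₃ → 2 * a ^ 2 * r = i₄ → p + 9 * b * r = i₅ →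
      ∃ n m ρ : ℤ, N * r = ρ ∧ p - 9 * b * r = m ∧ p + 3 * q = κ * m + τ * n)
    (β₁ β₂ β₃ : ℤ) :
    IsFreeGenerator H (Algebra.adjoin ℤ {α}) (ofCoords α β₁ β₂ β₃) ↔
      IsUnit ((τ * β₁ + E * β₃) * (A₂ * β₂ ^ 2 - A₃ * β₂ * β₃ + A₁ * β₃ ^ 2)) := by
  have hN' : (N : ℚ) ≠ 0 := Int.cast_ne_zero.2 hN
  have hτ' : (τ : ℚ) ≠ 0 := Int.cast_ne_zero.2 hτ
  have hb : (b : ℚ) ≠ 0 := Int.cast_ne_zero.2 (constCoeff_ne_zero hP hα)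
  -- The rational parameters with given integral coordinates.
  let r : (Fin 3 → ℤ) → ℚ := fun v => v 2 / N
  let p : (Fin 3 → ℤ) → ℚ := fun v => v 1 + 9 * b * r v
  let q : (Fin 3 → ℤ) → ℚ := fun v => (κ * v 1 + τ * v 0 - p v) / 3
  have hr : ∀ v, N * r v = v 2 := fun v => mul_div_cancel₀ _ hN'
  have hp : ∀ v, p v - 9 * b * r v = v 1 := fun v => by simp only [p]; ring
  have hq : ∀ v, p v + 3 * q v = κ * v 1 + τ * v 0 := fun v => by simp only [q]; ring
  have hvec : ∀ v : Fin 3 → ℤ, ![v 0, v 1, v 2] = v := fun v => by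
    funext i; fin_cases i <;> rfl
  have hact : ∀ (v : Fin 3 → ℤ) (x y z : ℤ),
      traceOperator P α a b (p v) (q v) (r v) (ofCoords α x y z) =
        (ofCoords α ((actionMatrix A₁ A₂ A₃ C D E κ τ x y z).mulVec v 0)
          ((actionMatrix A₁ A₂ A₃ C D E κ τ x y z).mulVec v 1)
          ((actionMatrix A₁ A₂ A₃ C D E κ τ x y z).mulVec v 2) : L) := by
    intro v x y z
    have := traceOperator_actionMatrix hP hN h₁ h₂ h₃ hC hD hE (hr v) (hp v) (hq v) x y z
    rwa [hvec] at this
  have hex : ∀ v, ∃ h : associatedOrder H (Algebra.adjoin ℤ {α}), ∀ x : L, (h : H) • x =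
      traceOperator P α a b (p v) (q v) (r v) x := by
    intro v
    obtain ⟨h, hh⟩ := exists_act_eq hP hα hH (p v) (q v) (r v)
    have hh' : ∀ x : L, h • x = traceOperator P α a b (p v) (q v) (r v) x :=
      LinearMap.congr_fun hh
    refine ⟨⟨h, fun x hx => ?_⟩, hh'⟩
    obtain ⟨x, y, z, rfl⟩ := (mem_adjoin_iff hα).1 hx
    rw [hh', ← coe_ofCoords, hact]
    exact SetLike.coe_mem _
  choose e he using hex
  have he_inj : Function.Injective e := by
    intro v v' hv
    have hop : ∀ x : L, traceOperator P α a b (p v) (q v) (r v) x =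
        traceOperator P α a b (p v') (q v') (r v') x := fun x => by rw [← he, ← he, hv]
    have k0 := traceOperator_coords (a := a) (b := b) hP (p v) (q v) (r v) 1 0 0
    rw [hop, traceOperator_coords hP] at k0
    have k1 := traceOperator_coords (a := a) (b := b) hP (p v) (q v) (r v) 0 1 0
    rw [hop, traceOperator_coords hP] at k1
    have k2 := traceOperator_coords (a := a) (b := b) hP (p v) (q v) (r v) 0 0 1
    rw [hop, traceOperator_coords hP] at k2
    have l0 := (coords_unique hP k0).1
    have l1 := (coords_unique hP k1).2.1
    have l2 := (coords_unique hP k2).2.2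
    push_cast at l0 l1 l2
    have m1 : (v 1 : ℚ) = v' 1 := by rw [← hp, ← hp]; linear_combination -l1
    have m2 : (v 2 : ℚ) = v' 2 := by
      rw [← hr, ← hr]
      congr 1
      apply mul_left_cancel₀ (mul_ne_zero (by norm_num : (18 : ℚ) ≠ 0) hb)
      linear_combination l1 - l2
    have m0 : (v 0 : ℚ) = v' 0 := by
      apply mul_left_cancel₀ hτ'
      linear_combination hq v' - hq v - l0 - κ * m1
    funext i
    fin_cases i
    · exact_mod_cast m0
    · exact_mod_cast m1
    · exact_mod_cast m2
  have he_surj : Function.Surjective e := by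
    intro h
    obtain ⟨p', q', r', hop⟩ := exists_act_eq_traceOperator hP hα hH (h : H)
    have hop' : ∀ x : L, (h : H) • x = traceOperator P α a b p' q' r' x :=
      LinearMap.congr_fun hop
    have hco : ∀ x y z : ℤ, ∃ i j k : ℤ,
        (x * (p' + 3 * q') + y * (4 * a ^ 2 * r') + z * (2 * a * q' - 6 * a * b * r') : ℚ) = i ∧
        (y * (p' - 9 * b * r') + z * (2 * a ^ 2 * r') : ℚ) = j ∧
        (y * (-6 * a * r') + z * (p' + 9 * b * r') : ℚ) = k := by
      intro x y z
      have hmem := h.2 _ ((mem_adjoin_iff hα).2 ⟨x, y, z, rfl⟩)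
      obtain ⟨i, j, k, hijk⟩ := (mem_adjoin_iff hα).1 hmem
      rw [hop', traceOperator_coords hP] at hijk
      exact ⟨i, j, k, coords_unique hP (by exact_mod_cast hijk)⟩
    obtain ⟨i₀, -, -, c₀, -, -⟩ := hco 1 0 0
    obtain ⟨-, i₁, i₂, -, c₁, c₂⟩ := hco 0 1 0
    obtain ⟨i₃, i₄, i₅, c₃, c₄, c₅⟩ := hco 0 0 1
    obtain ⟨n, m, ρ, g₁, g₂, g₃⟩ := hint p' q' r' i₀ i₁ (-i₂) i₃ i₄ i₅
      (by rw [← c₀]; push_cast; ring) (by rw [← c₁]; push_cast; ring)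
      (by push_cast; rw [← c₂]; push_cast; ring) (by rw [← c₃]; push_cast; ring)
      (by rw [← c₄]; push_cast; ring) (by rw [← c₅]; push_cast; ring)
    refine ⟨![n, m, ρ], Subtype.ext (act_injective hH ?_)⟩
    have t2 : r ![n, m, ρ] = r' := by
      apply mul_left_cancel₀ hN'
      rw [hr, g₁]; rfl
    have t1 : p ![n, m, ρ] = p' := by
      have := hp ![n, m, ρ]
      simp only [Matrix.cons_val_one, Matrix.cons_val_zero] at this
      linear_combination this - g₂ + 9 * b * t2
    have t0 : q ![n, m, ρ] = q' := by
      have := hq ![n, m, ρ]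
      simp only [Matrix.cons_val_one, Matrix.cons_val_zero] at this
      linear_combination (this - g₃ - t1) / 3
    rw [hop]
    ext x
    change (e ![n, m, ρ] : H) • x = _
    rw [he, t0, t1, t2]
  let M := actionMatrix A₁ A₂ A₃ C D E κ τ β₁ β₂ β₃
  have hcomp : (fun h : associatedOrder H (Algebra.adjoin ℤ {α}) => h • ofCoords α β₁ β₂ β₃) ∘ e =
      (fun v : Fin 3 → ℤ => ofCoords α (v 0) (v 1) (v 2)) ∘ M.mulVec := by
    funext v
    apply Subtype.ext
    change (e v : H) • (ofCoords α β₁ β₂ β₃ : L) = _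
    rw [he, hact]
    rfl
  rw [IsFreeGenerator, ← Function.Bijective.of_comp_iff _ ⟨he_inj, he_surj⟩, hcomp,
    Function.Bijective.of_comp_iff' (ofCoords_bijective hP hα), ← IsUnit.neg_iff,
    ← det_actionMatrix, ← Matrix.isUnit_iff_isUnit_det]
  refine ⟨fun h => Matrix.mulVec_surjective_iff_isUnit.1 h.2, fun h =>
    ⟨?_, Matrix.mulVec_surjective_iff_isUnit.2 h⟩⟩
  exact Matrix.mulVec_injective_of_isUnit h

end FreeGenerator

/-! ### Reduction to binary quadratic forms -/

section Arithmetic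

theorem represents_iff {A B C n : ℚ} {A' B' C' n' : ℤ} (hA : A = A') (hB : B = B') (hC : C = C')
    (hn : n = n') :
    Represents A B C n ↔ ∃ X Y : ℤ, A' * X ^ 2 + B' * X * Y + C' * Y ^ 2 = n' := by
  subst hA hB hC hn
  exact exists_congr fun X => exists_congr fun Y => by exact_mod_cast Iff.rfl

theorem not_three_dvd_of_emultiplicity_le {a b g a' b' : ℤ} (hg : g ≠ 0) (ha : a = g * a')
    (hb : b = g * b') (hcop : IsCoprime a' b') (h : emultiplicity 3 a ≤ emultiplicity 3 b) :
    ¬ (3 : ℤ) ∣ a' := by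
  intro h3
  rw [ha, hb, emultiplicity_mul Int.prime_three, emultiplicity_mul Int.prime_three] at h
  have hfin : emultiplicity 3 g ≠ ⊤ :=
    finiteMultiplicity_iff_emultiplicity_ne_top.1 (Int.finiteMultiplicity_iff.2 ⟨by decide, hg⟩)
  have h' := (ENat.add_le_add_iff_left hfin).1 h
  have hb3 : (3 : ℤ) ∣ b' :=
    dvd_of_emultiplicity_pos ((emultiplicity_pos_of_dvd h3).trans_le h')
  exact Int.prime_three.not_isUnit (hcop.isUnit_of_dvd' h3 hb3)

theorem three_dvd_of_emultiplicity_lt {a b g a' b' : ℤ} (ha : a = g * a')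
    (hb : b = g * b') (h : emultiplicity 3 b < emultiplicity 3 a) : (3 : ℤ) ∣ a' := by
  rw [ha, hb, emultiplicity_mul Int.prime_three, emultiplicity_mul Int.prime_three] at h
  by_contra h3
  rw [emultiplicity_eq_zero.2 h3, add_zero] at h
  exact absurd h (not_lt.2 le_self_add)

end Arithmetic

section Cases

variable {L : Type*} [Field L] [CharZero L] {α : L} {a b : ℤ} {P : Module.Basis (Fin 3) ℚ L}
  {H : Type*} [Ring H] [HopfAlgebra ℚ H] [Module H L] [IsScalarTower ℚ H L]

/-- The free generators when `3 ∤ a`. -/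
theorem isFreeGenerator_iff_of_not_three_dvd (hP : ∀ i, P i = α ^ (i : ℕ))
    (hα : α ^ 3 = a * α - b) (hH : IsHopfGalois ℚ L H) (h3 : ¬ (3 : ℤ) ∣ a) {g a' b' : ℤ}
    (hg : g ≠ 0) (ha : a = g * a') (hb : b = g * b') (hcop : IsCoprime a' b') (β₁ β₂ β₃ : ℤ) :
    IsFreeGenerator H (Algebra.adjoin ℤ {α}) (ofCoords α β₁ β₂ β₃) ↔
      IsUnit ((3 * β₁ + 2 * a * β₃) *
        (3 * a' * β₂ ^ 2 - 9 * b' * β₂ * β₃ + a * a' * β₃ ^ 2)) := by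
  refine isFreeGenerator_iff_isUnit hP hα hH (N := 2 * g) (C := 6 * a * b') (D := 0) (κ := 1)
    (mul_ne_zero two_ne_zero hg) three_ne_zero (by rw [ha]; ring) (by rw [ha]; ring)
    (by rw [hb]; ring) (by ring) (by ring) (by ring) ?_ β₁ β₂ β₃
  intro p q r i₀ i₁ i₂ i₃ i₄ i₅ e₀ e₁ e₂ e₃ e₄ e₅
  have hcop3 : IsCoprime (3 : ℤ) a := (Prime.coprime_iff_not_dvd Int.prime_three).2 h3
  obtain ⟨s, t, hst⟩ := hcop3
  -- `2 a` is a combination of `6 a` and `2 a²`, and `2 g` one of `2 a` and `18 b`.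
  have hcop9 : IsCoprime a' (9 * b') := by
    refine IsCoprime.mul_right ?_ hcop
    rw [show (9 : ℤ) = 3 ^ 2 by norm_num]
    refine (((Prime.coprime_iff_not_dvd Int.prime_three).2 fun h => h3 ?_).pow_left).symm
    exact ha ▸ h.mul_left g
  obtain ⟨x, y, hxy⟩ := hcop9
  have hst' : (s * 3 + t * a : ℚ) = 1 := by exact_mod_cast hst
  have hxy' : (x * a' + y * (9 * b') : ℚ) = 1 := by exact_mod_cast hxy
  have ha' : (a : ℚ) = g * a' := by exact_mod_cast ha
  have hb' : (b : ℚ) = g * b' := by exact_mod_cast hb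
  have hdvd : (3 : ℤ) ∣ 2 * a * (i₀ - i₁) := by
    refine ⟨i₃ + 2 * b * i₂, ?_⟩
    have : (2 * a * (i₀ - i₁) : ℚ) = 3 * (i₃ + 2 * b * i₂) := by
      rw [← e₀, ← e₁, ← e₂, ← e₃]; ring
    exact_mod_cast this
  obtain ⟨n, hn⟩ : (3 : ℤ) ∣ i₀ - i₁ := by
    rcases Int.prime_three.dvd_or_dvd hdvd with h | h
    · rcases Int.prime_three.dvd_or_dvd h with h | h
      · exact absurd h (by decide)
      · exact absurd h h3
    · exact h
  refine ⟨n, i₁, x * (s * i₂ + t * i₄) + y * (i₅ - i₁), ?_, e₁, ?_⟩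
  · push_cast
    rw [← e₁, ← e₂, ← e₄, ← e₅]
    linear_combination (-2 * g * r) * hxy' - 2 * x * r * a * hst' - 2 * x * r * ha' -
      18 * y * r * hb'
  · have : (i₀ - i₁ : ℚ) = 3 * n := by exact_mod_cast hn
    push_cast
    linear_combination e₀ + this

/-- The existence of free generators, and explicit ones, when `3 ∤ a`: the determinant of
`isFreeGenerator_iff_of_not_three_dvd` is a product of a linear and a quadratic form, which both
have to take the value `1` or `-1`. -/
theorem tfae_of_not_three_dvd (hP : ∀ i, P i = α ^ (i : ℕ))
    (hα : α ^ 3 = a * α - b) (hH : IsHopfGalois ℚ L H) (h3 : ¬ (3 : ℤ) ∣ a) {g a' b' Δ : ℤ}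
    (hg0 : g ≠ 0) (ha : a = g * a') (hb : b = g * b') (hcop : IsCoprime a' b')
    (hΔ : Δ = 4 * a ^ 3 - 27 * b ^ 2) :
    List.TFAE
      [Module.Free (associatedOrder H (Algebra.adjoin ℤ {α})) (Algebra.adjoin ℤ {α}),
        ∃ β₁ β₂ β₃ r s : ℤ, (r = 1 ∨ r = -1) ∧ (s = 1 ∨ s = -1) ∧ 3 * β₁ + 2 * a * β₃ = r ∧
          3 * a' * β₂ ^ 2 - 9 * b' * β₂ * β₃ + a * a' * β₃ ^ 2 = s,
        ∃ x y : ℤ,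
          (x ^ 2 + 3 * Δ * y ^ 2 = 12 * a * g ∨ x ^ 2 + 3 * Δ * y ^ 2 = -(12 * a * g)) ∧
          (6 * a ∣ 9 * b * y + x ∨ 6 * a ∣ 9 * b * y - x) ∧ ¬ (3 : ℤ) ∣ y] ∧
    ∀ x y β₁ β₂ : ℤ,
      (x ^ 2 + 3 * Δ * y ^ 2 = 12 * a * g ∨ x ^ 2 + 3 * Δ * y ^ 2 = -(12 * a * g)) →
      (3 * β₁ = 1 - 2 * a * y ∨ 3 * β₁ = -1 - 2 * a * y) →
      (6 * a * β₂ = 9 * b * y + x ∨ 6 * a * β₂ = 9 * b * y - x) →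
      IsFreeGenerator H (Algebra.adjoin ℤ {α}) (ofCoords α β₁ β₂ y) := by
  have ha0 : a ≠ 0 := fun h => h3 (h ▸ dvd_zero 3)
  have hgen := isFreeGenerator_iff_of_not_three_dvd hP hα hH h3 hg0 ha hb hcop
  -- Completing the square.
  have hsq : ∀ X Y : ℤ, (6 * a * X - 9 * b * Y) ^ 2 + 3 * Δ * Y ^ 2 =
      12 * a * g * (3 * a' * X ^ 2 - 9 * b' * X * Y + a * a' * Y ^ 2) := by
    intro X Y
    rw [hΔ]
    linear_combination (36 * a * X ^ 2 + 12 * a ^ 2 * Y ^ 2) * ha - 108 * a * X * Y * hb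
  have h12 : 12 * a * g ≠ 0 := mul_ne_zero (mul_ne_zero (by decide) ha0) hg0
  have hform : ∀ x y β₂ : ℤ,
      (x ^ 2 + 3 * Δ * y ^ 2 = 12 * a * g ∨ x ^ 2 + 3 * Δ * y ^ 2 = -(12 * a * g)) →
      (6 * a * β₂ = 9 * b * y + x ∨ 6 * a * β₂ = 9 * b * y - x) →
      3 * a' * β₂ ^ 2 - 9 * b' * β₂ * y + a * a' * y ^ 2 = 1 ∨
        3 * a' * β₂ ^ 2 - 9 * b' * β₂ * y + a * a' * y ^ 2 = -1 := by
    intro x y β₂ hx hβ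
    have hx2 : (6 * a * β₂ - 9 * b * y) ^ 2 = x ^ 2 := by
      rcases hβ with h | h <;> rw [h] <;> ring
    have hs := hsq β₂ y
    rw [hx2] at hs
    rcases hx with hx | hx
    · exact Or.inl (mul_left_cancel₀ h12 (by rw [← hs, hx]; ring))
    · exact Or.inr (mul_left_cancel₀ h12 (by rw [← hs, hx]; ring))
  constructor
  · tfae_have 1 → 2 := by
      intro h
      obtain ⟨β, hβ⟩ := (free_iff_exists_isFreeGenerator hP hα hH).1 h
      obtain ⟨v, rfl⟩ := (ofCoords_bijective hP hα).2 β
      obtain ⟨h1, h2⟩ := IsUnit.mul_iff.1 ((hgen _ _ _).1 hβ)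
      exact ⟨v 0, v 1, v 2, _, _, Int.isUnit_iff.1 h1, Int.isUnit_iff.1 h2, rfl,
        rfl⟩
    tfae_have 2 → 1 := by
      rintro ⟨β₁, β₂, β₃, r, s, hr, hs, h1, h2⟩
      refine (free_iff_exists_isFreeGenerator hP hα hH).2
        ⟨ofCoords α β₁ β₂ β₃, (hgen _ _ _).2 ?_⟩
      rw [h1, h2]
      exact (Int.isUnit_iff.2 hr).mul (Int.isUnit_iff.2 hs)
    tfae_have 2 → 3 := by
      rintro ⟨β₁, β₂, β₃, r, s, hr, hs, h1, h2⟩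
      refine ⟨6 * a * β₂ - 9 * b * β₃, β₃, ?_, Or.inl ⟨β₂, by ring⟩, ?_⟩
      · rw [hsq, h2]
        rcases hs with rfl | rfl
        · exact Or.inl (by ring)
        · exact Or.inr (by ring)
      · rintro ⟨k, rfl⟩
        have : (3 : ℤ) ∣ r := ⟨β₁ + 2 * a * k, by rw [← h1]; ring⟩
        exact Int.prime_three.not_isUnit (isUnit_of_dvd_unit this (Int.isUnit_iff.2 hr))
    tfae_have 3 → 2 := by
      rintro ⟨x, y, hx, hd, hy⟩
      have hβ : ∃ β₂, 6 * a * β₂ = 9 * b * y + x ∨ 6 * a * β₂ = 9 * b * y - x := by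
        rcases hd with ⟨β₂, h⟩ | ⟨β₂, h⟩
        · exact ⟨β₂, Or.inl h.symm⟩
        · exact ⟨β₂, Or.inr h.symm⟩
      obtain ⟨β₂, hβ⟩ := hβ
      have hay : ¬ (3 : ℤ) ∣ a * y := fun h => (Int.prime_three.dvd_or_dvd h).elim h3 hy
      have hβ₁ : ∃ β₁ r : ℤ, (r = 1 ∨ r = -1) ∧ 3 * β₁ + 2 * a * y = r := by
        have : ∃ k, a * y = 3 * k + 1 ∨ a * y = 3 * k - 1 :=
          ⟨(a * y + 1) / 3, by omega⟩
        obtain ⟨k, h | h⟩ := this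
        · exact ⟨-2 * k - 1, -1, Or.inr rfl, by linear_combination 2 * h⟩
        · exact ⟨-2 * k + 1, 1, Or.inl rfl, by linear_combination 2 * h⟩
      obtain ⟨β₁, r, hr, h1⟩ := hβ₁
      exact ⟨β₁, β₂, y, r, _, hr, hform x y β₂ hx hβ, h1, rfl⟩
    tfae_finish
  · intro x y β₁ β₂ hx hβ₁ hβ₂
    refine (hgen _ _ _).2 (IsUnit.mul (Int.isUnit_iff.2 ?_)
      (Int.isUnit_iff.2 (hform x y β₂ hx hβ₂)))
    rcases hβ₁ with h | h
    · exact Or.inl (by rw [h]; ring)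
    · exact Or.inr (by rw [h]; ring)

/-- The free generators when `3 ∣ a`, in terms of `G = gcd(a, 3 b)`. -/
theorem isFreeGenerator_iff_of_three_dvd (hP : ∀ i, P i = α ^ (i : ℕ))
    (hα : α ^ 3 = a * α - b) (hH : IsHopfGalois ℚ L H) {c G a' b' : ℤ} (hc : a = 3 * c)
    (hG : G ≠ 0) (ha : a = G * a') (hb : 3 * b = G * b') (hcop : IsCoprime a' b')
    (β₁ β₂ β₃ : ℤ) :
    IsFreeGenerator H (Algebra.adjoin ℤ {α}) (ofCoords α β₁ β₂ β₃) ↔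
      IsUnit ((1 * β₁ + 2 * c * β₃) * (a' * β₂ ^ 2 - b' * β₂ * β₃ + c * a' * β₃ ^ 2)) := by
  refine isFreeGenerator_iff_isUnit hP hα hH (N := 6 * G) (C := 2 * c * b') (D := -2 * c) (κ := 0)
    (mul_ne_zero (by decide) hG) one_ne_zero
    (by linear_combination (-2 * a) * hc - 6 * c * ha) (by rw [ha]; ring)
    (by linear_combination -6 * hb) (by rw [hc]; ring) (by rw [hc]; ring) (by rw [hc]; ring)
    ?_ β₁ β₂ β₃
  intro p q r i₀ i₁ i₂ i₃ i₄ i₅ e₀ e₁ e₂ e₃ e₄ e₅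
  obtain ⟨x, y, hxy⟩ := hcop
  have hxy' : (x * a' + y * b' : ℚ) = 1 := by exact_mod_cast hxy
  have ha' : (a : ℚ) = G * a' := by exact_mod_cast ha
  have hb' : (3 * b : ℚ) = G * b' := by exact_mod_cast hb
  refine ⟨i₀, i₁, x * i₂ + y * (i₅ - i₁), ?_, e₁, ?_⟩
  · push_cast
    rw [← e₁, ← e₂, ← e₅]
    linear_combination (-6 * G * r) * hxy' - 6 * x * r * ha' - 6 * y * r * hb'
  · push_cast
    linear_combination e₀

/-- The existence of free generators, and explicit ones, when `3 ∣ a`: the first coordinate of a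
free generator can be adjusted freely, which leaves a condition on a binary quadratic form. -/
theorem tfae_of_three_dvd (hP : ∀ i, P i = α ^ (i : ℕ))
    (hα : α ^ 3 = a * α - b) (hH : IsHopfGalois ℚ L H) {c G a' b' Δ : ℤ} (hc : a = 3 * c)
    (hG : G ≠ 0) (ha : a = G * a') (hb : 3 * b = G * b') (hcop : IsCoprime a' b')
    (hΔ : Δ = 4 * a ^ 3 - 27 * b ^ 2) :
    List.TFAE
      [Module.Free (associatedOrder H (Algebra.adjoin ℤ {α})) (Algebra.adjoin ℤ {α}),
        (∃ X Y : ℤ, a' * X ^ 2 + -b' * X * Y + c * a' * Y ^ 2 = 1) ∨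
          ∃ X Y : ℤ, a' * X ^ 2 + -b' * X * Y + c * a' * Y ^ 2 = -1,
        ∃ x y : ℤ,
          (x ^ 2 + 3 * Δ * y ^ 2 = 36 * a * G ∨ x ^ 2 + 3 * Δ * y ^ 2 = -(36 * a * G)) ∧
          (6 * a ∣ 9 * b * y + x ∨ 6 * a ∣ 9 * b * y - x)] ∧
    (a ≠ 0 → ∀ x y β₁ β₂ : ℤ,
      (x ^ 2 + 3 * Δ * y ^ 2 = 36 * a * G ∨ x ^ 2 + 3 * Δ * y ^ 2 = -(36 * a * G)) →
      3 * β₁ = 3 - 2 * a * y →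
      (6 * a * β₂ = 9 * b * y + x ∨ 6 * a * β₂ = 9 * b * y - x) →
      IsFreeGenerator H (Algebra.adjoin ℤ {α}) (ofCoords α β₁ β₂ y)) := by
  have hgen := isFreeGenerator_iff_of_three_dvd hP hα hH hc hG ha hb hcop
  -- Completing the square.
  have hsq : ∀ X Y : ℤ, (6 * a * X - 9 * b * Y) ^ 2 + 3 * Δ * Y ^ 2 =
      36 * a * G * (a' * X ^ 2 - b' * X * Y + c * a' * Y ^ 2) := by
    intro X Y
    rw [hΔ]
    linear_combination (36 * a * X ^ 2 + 36 * a * c * Y ^ 2) * ha - 36 * a * X * Y * hb +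
      12 * a ^ 2 * Y ^ 2 * hc
  have hform : a ≠ 0 → ∀ x y β₂ : ℤ,
      (x ^ 2 + 3 * Δ * y ^ 2 = 36 * a * G ∨ x ^ 2 + 3 * Δ * y ^ 2 = -(36 * a * G)) →
      (6 * a * β₂ = 9 * b * y + x ∨ 6 * a * β₂ = 9 * b * y - x) →
      a' * β₂ ^ 2 - b' * β₂ * y + c * a' * y ^ 2 = 1 ∨
        a' * β₂ ^ 2 - b' * β₂ * y + c * a' * y ^ 2 = -1 := by
    intro ha0 x y β₂ hx hβ
    have hx2 : (6 * a * β₂ - 9 * b * y) ^ 2 = x ^ 2 := by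
      rcases hβ with h | h <;> rw [h] <;> ring
    have h36 : 36 * a * G ≠ 0 := mul_ne_zero (mul_ne_zero (by decide) ha0) hG
    have hs := hsq β₂ y
    rw [hx2] at hs
    rcases hx with hx | hx
    · exact Or.inl (mul_left_cancel₀ h36 (by rw [← hs, hx]; ring))
    · exact Or.inr (mul_left_cancel₀ h36 (by rw [← hs, hx]; ring))
  constructor
  · tfae_have 1 → 2 := by
      intro h
      obtain ⟨β, hβ⟩ := (free_iff_exists_isFreeGenerator hP hα hH).1 h
      obtain ⟨v, rfl⟩ := (ofCoords_bijective hP hα).2 β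
      have := isUnit_of_mul_isUnit_right ((hgen _ _ _).1 hβ)
      rcases Int.isUnit_iff.1 this with h | h
      · exact Or.inl ⟨v 1, v 2, by linear_combination h⟩
      · exact Or.inr ⟨v 1, v 2, by linear_combination h⟩
    tfae_have 2 → 1 := by
      intro h
      have : ∃ X Y : ℤ, IsUnit (a' * X ^ 2 - b' * X * Y + c * a' * Y ^ 2) := by
        rcases h with ⟨X, Y, h⟩ | ⟨X, Y, h⟩
        · exact ⟨X, Y, Int.isUnit_iff.2 (Or.inl (by linear_combination h))⟩
        · exact ⟨X, Y, Int.isUnit_iff.2 (Or.inr (by linear_combination h))⟩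
      obtain ⟨X, Y, h⟩ := this
      refine (free_iff_exists_isFreeGenerator hP hα hH).2
        ⟨ofCoords α (1 - 2 * c * Y) X Y, (hgen _ _ _).2 ?_⟩
      rw [show 1 * (1 - 2 * c * Y) + 2 * c * Y = 1 by ring, one_mul]
      exact h
    tfae_have 2 → 3 := by
      rintro (⟨X, Y, h⟩ | ⟨X, Y, h⟩)
      · exact ⟨6 * a * X - 9 * b * Y, Y, Or.inl (by
          rw [hsq]; linear_combination 36 * a * G * h), Or.inl ⟨X, by ring⟩⟩
      · exact ⟨6 * a * X - 9 * b * Y, Y, Or.inr (by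
          rw [hsq]; linear_combination 36 * a * G * h), Or.inl ⟨X, by ring⟩⟩
    tfae_have 3 → 2 := by
      rintro ⟨x, y, hx, hd⟩
      by_cases ha0 : a = 0
      · -- Here `b'` is a unit and the form is `-b' X Y`.
        have ha' : a' = 0 := by
          have := ha.symm.trans ha0
          exact (mul_eq_zero.1 this).resolve_left hG
        rw [ha', isCoprime_zero_left, Int.isUnit_iff] at hcop
        rw [ha']
        rcases hcop with h | h
        · exact Or.inr ⟨1, 1, by rw [h]; ring⟩
        · exact Or.inl ⟨1, 1, by rw [h]; ring⟩
      · have hβ : ∃ β₂, 6 * a * β₂ = 9 * b * y + x ∨ 6 * a * β₂ = 9 * b * y - x := by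
          rcases hd with ⟨β₂, h⟩ | ⟨β₂, h⟩
          · exact ⟨β₂, Or.inl h.symm⟩
          · exact ⟨β₂, Or.inr h.symm⟩
        obtain ⟨β₂, hβ⟩ := hβ
        rcases hform ha0 x y β₂ hx hβ with h | h
        · exact Or.inl ⟨β₂, y, by linear_combination h⟩
        · exact Or.inr ⟨β₂, y, by linear_combination h⟩
    tfae_finish
  · intro ha0 x y β₁ β₂ hx hβ₁ hβ₂
    have h1 : 1 * β₁ + 2 * c * y = 1 := by
      apply mul_left_cancel₀ (three_ne_zero (α := ℤ))
      linear_combination hβ₁ - 2 * y * hc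
    rw [hgen, h1, one_mul]
    exact Int.isUnit_iff.2 (hform ha0 x y β₂ hx hβ₂)

end Cases

end HopfGaloisModule

open HopfGaloisModule in
theorem theorem1p1 {L : Type*} [Field L] [NumberField L] (α : L) (a b : ℤ)
    (hmin : minpoly ℚ α = X ^ 3 - C (a : ℚ) * X + C (b : ℚ))
    (hgen : ℚ⟮α⟯ = ⊤)
    (hval : ∀ p : ℕ, p.Prime → emultiplicity (p : ℤ) a ≤ 2 ∨ emultiplicity (p : ℤ) b ≤ 3)
    {H : Type*} [Ring H] [HopfAlgebra ℚ H] [Module H L] [IsScalarTower ℚ H L]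
    (hH : HopfGaloisModule.IsHopfGalois ℚ L H)
    (Δ g : ℤ) (hΔ : Δ = 4 * a ^ 3 - 27 * b ^ 2) (hg : g = (Int.gcd a b : ℤ)) :
    (¬ (3 : ℤ) ∣ a →
      List.TFAE
        [Module.Free (HopfGaloisModule.associatedOrder H (Algebra.adjoin ℤ {α}))
            (Algebra.adjoin ℤ {α}),
          ∃ β₁ β₂ β₃ r s : ℤ, (r = 1 ∨ r = -1) ∧ (s = 1 ∨ s = -1) ∧
            3 * β₁ + 2 * a * β₃ = r ∧
            3 * ((a : ℚ) / g) * β₂ ^ 2 - 9 * ((b : ℚ) / g) * β₂ * β₃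
              + ((a : ℚ) ^ 2 / g) * β₃ ^ 2 = s,
          ∃ x y : ℤ,
            (x ^ 2 + 3 * Δ * y ^ 2 = 12 * a * g ∨ x ^ 2 + 3 * Δ * y ^ 2 = -(12 * a * g)) ∧
            (6 * a ∣ 9 * b * y + x ∨ 6 * a ∣ 9 * b * y - x) ∧ ¬ (3 : ℤ) ∣ y] ∧
      ∀ x y β₁ β₂ : ℤ,
        (x ^ 2 + 3 * Δ * y ^ 2 = 12 * a * g ∨ x ^ 2 + 3 * Δ * y ^ 2 = -(12 * a * g)) →
        (3 * β₁ = 1 - 2 * a * y ∨ 3 * β₁ = -1 - 2 * a * y) →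
        (6 * a * β₂ = 9 * b * y + x ∨ 6 * a * β₂ = 9 * b * y - x) →
        HopfGaloisModule.IsFreeGenerator H (Algebra.adjoin ℤ {α})
          (HopfGaloisModule.ofCoords α β₁ β₂ y)) ∧
    ((3 : ℤ) ∣ a → emultiplicity 3 a ≤ emultiplicity 3 b →
      List.TFAE
        [Module.Free (HopfGaloisModule.associatedOrder H (Algebra.adjoin ℤ {α}))
            (Algebra.adjoin ℤ {α}),
          HopfGaloisModule.Represents (a / g) (-3 * (b / g)) (a ^ 2 / (3 * g)) 1 ∨
            HopfGaloisModule.Represents (a / g) (-3 * (b / g)) (a ^ 2 / (3 * g)) (-1),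
          ∃ x y : ℤ,
            (x ^ 2 + 3 * Δ * y ^ 2 = 36 * a * g ∨ x ^ 2 + 3 * Δ * y ^ 2 = -(36 * a * g)) ∧
            (6 * a ∣ 9 * b * y + x ∨ 6 * a ∣ 9 * b * y - x)] ∧
      ∀ x y β₁ β₂ : ℤ,
        (x ^ 2 + 3 * Δ * y ^ 2 = 36 * a * g ∨ x ^ 2 + 3 * Δ * y ^ 2 = -(36 * a * g)) →
        3 * β₁ = 3 - 2 * a * y →
        (6 * a * β₂ = 9 * b * y + x ∨ 6 * a * β₂ = 9 * b * y - x) →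
        HopfGaloisModule.IsFreeGenerator H (Algebra.adjoin ℤ {α})
          (HopfGaloisModule.ofCoords α β₁ β₂ y)) ∧
    (emultiplicity 3 b < emultiplicity 3 a →
      List.TFAE
        [Module.Free (HopfGaloisModule.associatedOrder H (Algebra.adjoin ℤ {α}))
            (Algebra.adjoin ℤ {α}),
          HopfGaloisModule.Represents (a / (3 * g)) (-(b / g)) (a ^ 2 / (9 * g)) 1 ∨
            HopfGaloisModule.Represents (a / (3 * g)) (-(b / g)) (a ^ 2 / (9 * g)) (-1),
          ∃ x y : ℤ,
            (x ^ 2 + 3 * Δ * y ^ 2 = 108 * a * g ∨ x ^ 2 + 3 * Δ * y ^ 2 = -(108 * a * g)) ∧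
            (6 * a ∣ 9 * b * y + x ∨ 6 * a ∣ 9 * b * y - x)] ∧
      (a ≠ 0 → ∀ x y β₁ β₂ : ℤ,
        (x ^ 2 + 3 * Δ * y ^ 2 = 108 * a * g ∨ x ^ 2 + 3 * Δ * y ^ 2 = -(108 * a * g)) →
        3 * β₁ = 3 - 2 * a * y →
        (6 * a * β₂ = 9 * b * y + x ∨ 6 * a * β₂ = 9 * b * y - x) →
        HopfGaloisModule.IsFreeGenerator H (Algebra.adjoin ℤ {α})
          (HopfGaloisModule.ofCoords α β₁ β₂ y))) := by
  have hdeg : (minpoly ℚ α).natDegree = 3 := by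
    rw [hmin]
    compute_degree!
  obtain ⟨P, hP⟩ := exists_powerBasis hdeg hgen
  have hα : α ^ 3 = a * α - b := by
    have h := minpoly.aeval ℚ α
    rw [hmin] at h
    simp only [map_add, map_sub, map_mul, map_pow, aeval_X, map_intCast] at h
    linear_combination h
  have hb0 : b ≠ 0 := constCoeff_ne_zero hP hα
  have hg0 : g ≠ 0 := by
    rw [hg]
    exact_mod_cast Int.gcd_ne_zero_right hb0
  obtain ⟨a', ha⟩ : g ∣ a := hg ▸ Int.gcd_dvd_left a b
  obtain ⟨b', hb⟩ : g ∣ b := hg ▸ Int.gcd_dvd_right a b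
  have hcop : IsCoprime a' b' := by
    have h := Int.gcd_eq_gcd_ab a b
    rw [← hg] at h
    refine ⟨Int.gcdA a b, Int.gcdB a b, mul_left_cancel₀ hg0 ?_⟩
    linear_combination -h - Int.gcdA a b * ha - Int.gcdB a b * hb
  have hgQ : (g : ℚ) ≠ 0 := Int.cast_ne_zero.2 hg0
  have haQ : (a : ℚ) = g * a' := by exact_mod_cast ha
  have hbQ : (b : ℚ) = g * b' := by exact_mod_cast hb
  have haq : (a : ℚ) / g = a' := by rw [haQ, mul_div_cancel_left₀ _ hgQ]
  have hbq : (b : ℚ) / g = b' := by rw [hbQ, mul_div_cancel_left₀ _ hgQ]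
  refine ⟨fun h3 => ?_, fun h3 hle => ?_, fun hlt => ?_⟩
  · have haq2 : (a : ℚ) ^ 2 / g = (a * a' : ℤ) := by
      push_cast; rw [← haq]; ring
    have hcast : ∀ β₂ β₃ s : ℤ, 3 * ((a : ℚ) / g) * β₂ ^ 2 - 9 * ((b : ℚ) / g) * β₂ * β₃
        + ((a : ℚ) ^ 2 / g) * β₃ ^ 2 = s ↔
        3 * a' * β₂ ^ 2 - 9 * b' * β₂ * β₃ + a * a' * β₃ ^ 2 = s := by
      intro β₂ β₃ s
      rw [haq, hbq, haq2]
      exact_mod_cast Iff.rfl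
    simp only [hcast]
    exact tfae_of_not_three_dvd hP hα hH h3 hg0 ha hb hcop hΔ
  · obtain ⟨c, hc⟩ := h3
    have ha3 := not_three_dvd_of_emultiplicity_le hg0 ha hb hcop hle
    have ha0 : a ≠ 0 := by
      rintro rfl
      have : a' = 0 := (mul_eq_zero.1 ha.symm).resolve_left hg0
      exact ha3 (this ▸ dvd_zero 3)
    have hcop' : IsCoprime a' (3 * b') :=
      IsCoprime.mul_right ((Prime.coprime_iff_not_dvd Int.prime_three).2 ha3).symm hcop
    obtain ⟨ht, hm⟩ := tfae_of_three_dvd hP hα hH hc hg0 ha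
      (show 3 * b = g * (3 * b') by rw [hb]; ring) hcop' hΔ
    have hB : -3 * ((b : ℚ) / g) = (-(3 * b') : ℤ) := by rw [hbq]; push_cast; ring
    have hC : (a : ℚ) ^ 2 / (3 * g) = (c * a' : ℤ) := by
      have hcQ : (a : ℚ) = 3 * c := by exact_mod_cast hc
      push_cast
      rw [← haq, hcQ]
      field_simp
    rw [represents_iff haq hB hC Int.cast_one.symm,
      represents_iff haq hB hC (by norm_num : (-1 : ℚ) = (-1 : ℤ))]
    exact ⟨ht, hm ha0⟩
  · obtain ⟨a₃, ha₃⟩ := three_dvd_of_emultiplicity_lt ha hb hlt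
    have hc : a = 3 * (g * a₃) := by rw [ha, ha₃]; ring
    have hcop' : IsCoprime a₃ b' := by
      rw [ha₃] at hcop
      exact hcop.of_mul_left_right
    obtain ⟨ht, hm⟩ := tfae_of_three_dvd hP hα hH (G := 3 * g) hc
      (mul_ne_zero three_ne_zero hg0) (by rw [hc]; ring)
      (show 3 * b = 3 * g * b' by rw [hb]; ring) hcop' hΔ
    have haQ' : (a : ℚ) = 3 * (g * a₃) := by exact_mod_cast hc
    have hA : (a : ℚ) / (3 * g) = a₃ := by rw [haQ']; field_simp
    have hB : -((b : ℚ) / g) = (-b' : ℤ) := by rw [hbq]; push_cast; ring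
    have hC : (a : ℚ) ^ 2 / (9 * g) = (g * a₃ * a₃ : ℤ) := by
      push_cast
      rw [haQ']
      field_simp
      ring
    rw [represents_iff hA hB hC Int.cast_one.symm,
      represents_iff hA hB hC (by norm_num : (-1 : ℚ) = (-1 : ℤ)),
      show 108 * a * g = 36 * a * (3 * g) by ring]
    exact ⟨ht, hm⟩
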